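/- A testing problem is a pair $(P,Q)$ of probability distributions on a common measurable space $\Omega$. Write $(P,Q)\preceq(P',Q')$ (Blackwell order) if there is a Markov kernel $\phi$ from $\Omega'$ to $\Omega$ with $P=\phi P'$ and $Q=\phi Q'$. The privacy loss distribution $\operatorname{PLD}(P\|Q)$ is the law on $\mathbb{R}\cup\{\infty\}$ of $\log\frac{dP}{dQ}(\omega)$, $\omega\sim P$, where $\frac{dP}{dQ}$ is the ratio of the densities of $P$ and $Q$ with respect to $P+Q$ (with $a/0=\infty$ for $a>0$). A PLD is a distribution of this form; for PLDs, $L\preceq L'$ means that there are testing problems $(P,Q)\preceq(P',Q')$ with $\operatorname{PLD}(P\|Q)=L$ and $\operatorname{PLD}(P'\|Q')=L'$. The hockey-stick curve of a PLD $L$ is $h_L(x)=\mathbb{E}_{Z\sim L}[(1-xe^{-Z})_+]$, $x>0$; the hockey-stick curve of $(P,Q)$ is $H_x(P\|Q)=\sup_E\big(P(E)-xQ(E)\big)$, the supremum being over events $E$. The tradeoff curve of $(P,Q)$ is $$T_\alpha(P\|Q)=\inf\Big\{\int(1-\varphi)\,dQ \;:\; \varphi:\Omega\to[0,1]\text{ measurable},\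 \int\varphi\,dP\le\alpha\Big\},\qquad \alpha\in[0,1],$$ the least type II error of a (randomized) test with type I error at most $\alpha$. The tradeoff curve $\tau_L$ of a PLD $L$ is that of any testing problem with PLD $L$. **Proposition.** Let $\mathcal{L}$ be a nonempty family of PLDs that is dominated by at least one PLD. Then there is a unique PLD $\sup\mathcal{L}$ that dominates every member of $\mathcal{L}$ and is dominated by every upper bound of $\mathcal{L}$. Moreover: (i) $h_{\sup\mathcal{L}}(x)=\sup\{h_L(x):L\in\mathcal{L}\}$ for all $x>0$. Likewise, for every testing problem $(P,Q)$ with PLD $\sup\mathcal{L}$ and every $x>0$, $H_x(P\|Q)$ is the supremum of $H_x(P'\|Q')$ over all testing problems $(P',Q')$ whose PLD belongs to $\mathcal{L}$. (ii) $\tau_{\sup\mathcal{L}}$ is the lower convex envelope of $\{\tau_L:L\in\mathcal{L}\}$: for every testing problem $(P,Q)$ with PLD $\sup\mathcal{L}$ and every $\alpha\in[0,1]$, $$T_\alpha(P\|Q)=\sup\{f(\alpha): f:[0,1]\to\mathbb{R}\text{ convex and continuous},\ f\le\tau_L\text{ on }[0,1]\text{ for all }L\in\mathcal{L}\},$$ and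 for $\alpha\in(0,1]$ the same holds with the supremum over all convex $f:[0,1]\to\mathbb{R}$, continuous or not, with $f\le\tau_L$ on $[0,1]$ for all $L\in\mathcal{L}$. -/

import Mathlib

open MeasureTheory ProbabilityTheory Set

/-- A testing problem: a pair of probability distributions `(P, Q)` on a common measurable
space. -/
structure TestingPair : Type 1 where
  Ω : Type
  mΩ : MeasurableSpace Ω
  P : @Measure Ω mΩ
  Q : @Measure Ω mΩ
  probP : @IsProbabilityMeasure Ω mΩ P
  probQ : @IsProbabilityMeasure Ω mΩ Q

attribute [instance] TestingPair.mΩ TestingPair.probP TestingPair.probQ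

noncomputable section

namespace TestingPair

/-- The Blackwell order on testing problems: `E` is obtained from `E'` by passing both
distributions through one Markov kernel. -/
def BlackwellLE (E E' : TestingPair) : Prop :=
  ∃ κ : Kernel E'.Ω E.Ω, IsMarkovKernel κ ∧ E.P = E'.P.bind κ ∧ E.Q = E'.Q.bind κ

/-- The likelihood ratio `dP/dQ`, computed from the densities with respect to `P + Q`.
In `ENNReal`, `a / 0 = ∞` for `a ≠ 0`; both densities vanish only on a `P`-null set. -/
def likelihoodRatio (E : TestingPair) (ω : E.Ω) : ENNReal :=
  E.P.rnDeriv (E.P + E.Q) ω / E.Q.rnDeriv (E.P + E.Q) ω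

/-- The law of `log (dP/dQ) (ω)` for `ω ∼ P`, as a measure on the extended reals. (It gives no
mass to `-∞`, so it lives on `ℝ ∪ {∞}`.) -/
def privacyLossLaw (E : TestingPair) : Measure EReal :=
  E.P.map fun ω => ENNReal.log (E.likelihoodRatio ω)

/-- The hockey-stick divergence of order `x`: the supremum of `P(A) - x Q(A)` over all
events `A`. -/
def hockeyStick (E : TestingPair) (x : ℝ) : ℝ :=
  sSup {y | ∃ A : Set E.Ω, MeasurableSet A ∧ y = E.P.real A - x * E.Q.real A}

/-- The tradeoff curve: the least type II error among the (randomized) tests of type I error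
at most `α`. Here `φ ω` is the probability with which the test decides for `Q` when it
observes `ω`. -/
def tradeoff (E : TestingPair) (α : ℝ) : ℝ :=
  sInf {b | ∃ φ : E.Ω → ℝ, Measurable φ ∧ (∀ ω, φ ω ∈ Icc (0 : ℝ) 1) ∧
    ∫ ω, φ ω ∂E.P ≤ α ∧ b = ∫ ω, (1 - φ ω) ∂E.Q}

end TestingPair

/-- Privacy loss distributions (PLDs): the distributions that are the privacy loss law of some
testing problem. -/
def PLD : Type := {L : Measure EReal // ∃ E : TestingPair, E.privacyLossLaw = L}

/-- `PLD(P ‖ Q)`. -/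
def TestingPair.pld (E : TestingPair) : PLD := ⟨E.privacyLossLaw, E, rfl⟩

/-- The Blackwell order on PLDs. -/
instance : LE PLD where
  le L L' := ∃ E E' : TestingPair, E.pld = L ∧ E'.pld = L' ∧ E.BlackwellLE E'

/-- The hockey-stick curve of a PLD, `h_L(x) = 𝔼_{Z ∼ L} [(1 - x e^{-Z})₊]`. The subtraction
takes place in `ENNReal`, where it is truncated at `0`. -/
def PLD.hockeyStick (L : PLD) (x : ℝ) : ℝ :=
  ∫ z, (1 - ENNReal.ofReal x * EReal.exp (-z)).toReal ∂L.1

/-- The real functions that are convex on `[0, 1]` and lie below every member of `F` there. -/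
def convexMinorants (F : Set (ℝ → ℝ)) : Set (ℝ → ℝ) :=
  {f | ConvexOn ℝ (Icc 0 1) f ∧ ∀ g ∈ F, ∀ a ∈ Icc (0 : ℝ) 1, f a ≤ g a}

/-- The lower convex envelope on `[0, 1]`: the pointwise supremum of the convex minorants. -/
def lowerConvexEnvelope (F : Set (ℝ → ℝ)) (a : ℝ) : ℝ :=
  sSup {y | ∃ f ∈ convexMinorants F, f a = y}

/-- The closed lower convex envelope on `[0, 1]`: the pointwise supremum of the continuous
convex minorants. -/
def closedLowerConvexEnvelope (F : Set (ℝ → ℝ)) (a : ℝ) : ℝ :=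
  sSup {y | ∃ f ∈ convexMinorants F, ContinuousOn f (Icc 0 1) ∧ f a = y}

/-- The tradeoff curves `τ_L`, `L ∈ 𝓛`, i.e. the tradeoff curves of the testing problems whose
PLD belongs to `𝓛`. -/
def tradeoffCurves (𝓛 : Set PLD) : Set (ℝ → ℝ) :=
  {τ | ∃ E : TestingPair, E.pld ∈ 𝓛 ∧ τ = E.tradeoff}

end

/-! A testing problem is encoded by the law `μ` on `[0,1]` of `y = dQ/d(P+Q)` under `P + Q`, a
measure of mass 2 and barycentre 1. It determines the PLD. Since `P - xQ` has density `1 - (1+x)y`,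
the hockey-stick curve is `(1+x) u(1/(1+x))`, where `u(t) = ∫ (t-y)₊ dμ` is the potential of `μ`.

Everything about the order is then read off potentials. A convex function is affine plus a mixture
of kinks, so ordered potentials mean convex order (`integral_convex_le_of_potential_le`). Strassen's
theorem (`exists_martingale_coupling`) turns convex order into a martingale coupling, whose
disintegration is the Markov kernel required by the Blackwell order. The converse is data
processing. The potentials are exactly the convex functions equal to `0` for `t ≤ 0` and to `2t - 1`
for `t ≥ 1` (`exists_isDichotomyLaw_of_convexOn`). This class is closed under pointwise suprema, so
suprema of PLDs exist and have the supremum of the hockey-stick curves.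

For tradeoff curves, convex duality applies: each line `β ↦ (1 - β - H_x)/x` lies below `T`, and a
supporting line of slope `s < 0` corresponds to `x = -1/s`. A convex minorant of all the `τ_L`
bounds every `H_x` of the family with one and the same `x`, hence bounds that of the supremum.
Conversely the lines of the supremum are themselves minorants. Continuity matters only at `α = 0`,
where a convex function may jump up. -/

open unitInterval

/-! ### Convex functions as mixtures of kinks -/

/-- A convex function on the line is the integral of a Stieltjes function. -/
theorem ConvexOn.exists_stieltjesFunction {c : ℝ → ℝ} (hc : ConvexOn ℝ univ c) :
    ∃ F : StieltjesFunction ℝ, ∀ a b, a ≤ b → c b - c a = ∫ s in a..b, F s := by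
  have hmono : Monotone fun x => derivWithin c (Ioi x) x := by
    have := hc.monotoneOn_rightDeriv
    rwa [interior_univ, monotoneOn_univ] at this
  refine ⟨hmono.stieltjesFunction, fun a b hab => ?_⟩
  have hcont : Continuous c := by
    rw [← continuousOn_univ]
    exact hc.continuousOn isOpen_univ
  have h1 : ∫ s in a..b, derivWithin c (Ioi s) s = c b - c a := by
    refine intervalIntegral.integral_eq_sub_of_hasDeriv_right_of_le hab hcont.continuousOn
      (fun x _ => hc.hasDerivWithinAt_rightDeriv_of_mem_interior (by simp)) ?_
    exact hmono.intervalIntegrable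
  rw [← h1]
  -- The Stieltjes function is the right limit of the right derivative; the two differ at most at
  -- countably many points.
  refine intervalIntegral.integral_congr_ae ?_
  have hcount : {x | ¬ ContinuousAt (fun x => derivWithin c (Ioi x) x) x}.Countable :=
    hmono.countable_not_continuousAt
  filter_upwards [hcount.ae_notMem volume] with x hx _
  rw [hmono.stieltjesFunction_eq]
  exact (rightLim_eq_of_tendsto ((not_not.1 hx).tendsto.mono_left nhdsWithin_le_nhds)).symm

theorem StieltjesFunction.mul_sub_le_integral (F : StieltjesFunction ℝ) {a b : ℝ} (hab : a ≤ b) :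
    F a * (b - a) ≤ ∫ s in a..b, F s := by
  have := intervalIntegral.integral_mono_on hab (f := fun _ => F a) (g := F) (μ := volume)
    (by simp) F.mono.intervalIntegrable (fun x hx => F.mono hx.1)
  simpa [mul_comm] using this

theorem StieltjesFunction.integral_le_mul_sub (F : StieltjesFunction ℝ) {a b : ℝ} (hab : a ≤ b) :
    ∫ s in a..b, F s ≤ F b * (b - a) := by
  have := intervalIntegral.integral_mono_on hab (f := F) (g := fun _ => F b) (μ := volume)
    F.mono.intervalIntegrable (by simp) (fun x hx => F.mono hx.2)
  simpa [mul_comm] using this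

/-- Taylor's formula with integral remainder, for the primitive of a Stieltjes function. -/
theorem StieltjesFunction.integral_eq_add_integral_max (F : StieltjesFunction ℝ) {a b y : ℝ}
    (hay : a ≤ y) (hyb : y ≤ b) :
    ∫ s in a..y, F s = F a * (y - a) + ∫ t in Ioc a b, max (y - t) 0 ∂F.measure := by
  have hfin : IsFiniteMeasure (F.measure.restrict (Ioc a b)) :=
    ⟨by rw [Measure.restrict_apply_univ, F.measure_Ioc]; exact ENNReal.ofReal_lt_top⟩
  set S : Set (ℝ × ℝ) := {p | p.2 ≤ p.1} with hS
  have hSm : MeasurableSet S := measurableSet_le measurable_snd measurable_fst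
  -- `F s - F a` is the mass of `Ioc a s`. After Fubini, `t` contributes the length of `Icc t y`,
  -- which is `(y - t)₊`.
  have hF : ∀ s ∈ Ioc a y, F s = F a + ∫ t in Ioc a b, S.indicator 1 (s, t) ∂F.measure := by
    intro s hs
    have : (fun t => S.indicator (1 : ℝ × ℝ → ℝ) (s, t)) = (Iic s).indicator 1 := by
      ext t; simp [hS, indicator_apply]
    rw [this, integral_indicator_one measurableSet_Iic, measureReal_restrict_apply measurableSet_Iic]
    have h2 : Iic s ∩ Ioc a b = Ioc a s := by
      ext t; simp only [mem_inter_iff, mem_Iic, mem_Ioc]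
      constructor
      · rintro ⟨h1, h2, h3⟩; exact ⟨h2, h1⟩
      · rintro ⟨h1, h2⟩; exact ⟨h2, h1, h2.trans (hs.2.trans hyb)⟩
    rw [h2, Measure.real, F.measure_Ioc, ENNReal.toReal_ofReal (sub_nonneg.2 (F.mono hs.1.le))]
    ring
  have hint : Integrable (S.indicator (1 : ℝ × ℝ → ℝ))
      ((volume.restrict (Ioc a y)).prod (F.measure.restrict (Ioc a b))) :=
    (integrable_const (1 : ℝ)).indicator hSm
  rw [intervalIntegral.integral_of_le hay, setIntegral_congr_fun measurableSet_Ioc hF,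
    integral_add (integrable_const _) hint.integral_prod_left, setIntegral_const,
    integral_integral_swap (f := fun s t => S.indicator (1 : ℝ × ℝ → ℝ) (s, t)) hint]
  refine congrArg₂ (· + ·) ?_ ?_
  · rw [Real.volume_real_Ioc_of_le hay, smul_eq_mul, mul_comm]
  · refine setIntegral_congr_fun measurableSet_Ioc fun t ht => ?_
    have : (fun s => S.indicator (1 : ℝ × ℝ → ℝ) (s, t)) = (Ici t).indicator 1 := by
      ext t; simp [hS, indicator_apply]
    rw [this, integral_indicator_one measurableSet_Ici, measureReal_restrict_apply measurableSet_Ici]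
    have h2 : Ici t ∩ Ioc a y = Icc t y := by
      ext s; simp only [mem_inter_iff, mem_Ici, mem_Ioc, mem_Icc]
      exact ⟨fun h => ⟨h.1, h.2.2⟩, fun h => ⟨h.1, ht.1.trans_le h.1, h.2⟩⟩
    rw [h2, Measure.real, Real.volume_Icc, ENNReal.toReal_ofReal']

/-! ### Potentials and the convex order -/

/-- The potential `t ↦ ∫ (t - y)₊ dμ` of a measure on the unit interval. -/
noncomputable def potential (μ : Measure I) (t : ℝ) : ℝ := ∫ y : I, max (t - y) 0 ∂μ

theorem Continuous.integrable_unitInterval {μ : Measure I} [IsFiniteMeasure μ] {f : I → ℝ}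
    (hf : Continuous f) : Integrable f μ :=
  (hf.integrable_of_hasCompactSupport (HasCompactSupport.of_compactSpace f))

/-- The call-option transform in terms of the potential, the mass and the barycentre. -/
theorem integral_max_sub_eq_potential {μ : Measure I} [IsFiniteMeasure μ] (t : ℝ) :
    ∫ y : I, max (y - t) 0 ∂μ = potential μ t + ∫ y : I, (y : ℝ) ∂μ - t * μ.real univ := by
  have h : ∀ y : I, max ((y : ℝ) - t) 0 = max (t - y) 0 + (y - t) := fun y => by
    rcases le_total (y : ℝ) t with h | h
    · rw [max_eq_right (by linarith), max_eq_left (by linarith)]; ring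
    · rw [max_eq_left (by linarith), max_eq_right (by linarith)]; ring
  simp_rw [h]
  rw [integral_add (by fun_prop : Continuous _).integrable_unitInterval
    (by fun_prop : Continuous _).integrable_unitInterval,
    integral_sub (by fun_prop : Continuous _).integrable_unitInterval
    (by fun_prop : Continuous _).integrable_unitInterval, potential]
  simp
  ring

/-- The integral of a convex function in terms of the potential. -/
theorem StieltjesFunction.integral_eq_of_convex {c : ℝ → ℝ} {F : StieltjesFunction ℝ}
    (hF : ∀ a b, a ≤ b → c b - c a = ∫ s in a..b, F s) (μ : Measure I) [IsFiniteMeasure μ] :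
    ∫ y : I, c y ∂μ = c 0 * μ.real univ + F 0 * ∫ y : I, (y : ℝ) ∂μ
      + ∫ t in Ioc (0 : ℝ) 1, (∫ y : I, max (y - t) 0 ∂μ) ∂F.measure := by
  have hfin : IsFiniteMeasure (F.measure.restrict (Ioc 0 1)) :=
    ⟨by rw [Measure.restrict_apply_univ, F.measure_Ioc]; exact ENNReal.ofReal_lt_top⟩
  have hint : Integrable (fun p : I × ℝ => max ((p.1 : ℝ) - p.2) 0)
      (μ.prod (F.measure.restrict (Ioc 0 1))) := by
    refine Integrable.of_bound (C := 1) (by fun_prop : Continuous _).aestronglyMeasurable ?_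
    have : ∀ᵐ p ∂(μ.prod (F.measure.restrict (Ioc 0 1))), p.2 ∈ Ioc (0 : ℝ) 1 :=
      Measure.quasiMeasurePreserving_snd.ae (ae_restrict_mem measurableSet_Ioc)
    filter_upwards [this] with p hp
    rw [Real.norm_of_nonneg (le_max_right _ _)]
    exact max_le (by linarith [p.1.2.2, hp.1]) zero_le_one
  have hc : ∀ y : I, c y = c 0 + F 0 * y + ∫ t in Ioc (0 : ℝ) 1, max (y - t) 0 ∂F.measure := by
    intro y
    have h1 := hF 0 y y.2.1
    rw [F.integral_eq_add_integral_max y.2.1 y.2.2] at h1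
    linarith
  simp_rw [hc]
  rw [integral_add (by fun_prop : Continuous _).integrable_unitInterval hint.integral_prod_left,
    integral_add (by fun_prop : Continuous _).integrable_unitInterval
    (by fun_prop : Continuous _).integrable_unitInterval,
    integral_integral_swap (f := fun (y : I) t => max ((y : ℝ) - t) 0) hint, integral_const_mul]
  simp [mul_comm]

/-- Measures on the unit interval with the same mass and barycentre are in the convex order as
soon as their potentials are ordered. -/
theorem integral_convex_le_of_potential_le {μ ν : Measure I} [IsFiniteMeasure μ] [IsFiniteMeasure ν]
    (hmass : μ.real univ = ν.real univ) (hmean : ∫ y : I, (y : ℝ) ∂μ = ∫ y : I, (y : ℝ) ∂ν)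
    (hpot : ∀ t ∈ Ioo (0 : ℝ) 1, potential μ t ≤ potential ν t) {c : ℝ → ℝ}
    (hc : ConvexOn ℝ univ c) : ∫ y : I, c y ∂μ ≤ ∫ y : I, c y ∂ν := by
  obtain ⟨F, hF⟩ := hc.exists_stieltjesFunction
  have hfin : IsFiniteMeasure (F.measure.restrict (Ioc 0 1)) :=
    ⟨by rw [Measure.restrict_apply_univ, F.measure_Ioc]; exact ENNReal.ofReal_lt_top⟩
  have hint : ∀ (ρ : Measure I) [IsFiniteMeasure ρ],
      IntegrableOn (fun t : ℝ => ∫ y : I, max (y - t) 0 ∂ρ) (Ioc 0 1) F.measure := by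
    intro ρ _
    refine Integrable.of_bound (C := ρ.real univ) ?_ ?_
    · exact (StronglyMeasurable.integral_prod_right (ν := ρ) (f := fun (t : ℝ) (y : I) => max (y - t) 0)
        (by fun_prop : Continuous _).stronglyMeasurable).aestronglyMeasurable
    · filter_upwards [ae_restrict_mem measurableSet_Ioc] with t ht
      refine (norm_integral_le_of_norm_le_const (C := 1) (.of_forall fun y => ?_)).trans (by simp)
      rw [Real.norm_of_nonneg (le_max_right _ _)]
      exact max_le (by linarith [y.2.2, ht.1]) zero_le_one
  -- Mass and barycentre fix the affine part; what remains is a mixture of call options with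
  -- nonnegative weights.
  rw [F.integral_eq_of_convex hF, F.integral_eq_of_convex hF, hmass, hmean]
  refine add_le_add_right (setIntegral_mono_on (hint μ) (hint ν) measurableSet_Ioc fun t ht => ?_) _
  -- The measure of `F` may charge `t = 1`, but there both call integrals vanish.
  rcases ht.2.lt_or_eq with h1 | rfl
  · rw [integral_max_sub_eq_potential, integral_max_sub_eq_potential, hmass, hmean]
    linarith [hpot t ⟨ht.1, h1⟩]
  · have : ∀ y : I, max ((y : ℝ) - 1) 0 = 0 := fun y => max_eq_right (by linarith [y.2.2])
    simp [this]

/-- The supremum of a uniformly bounded family of affine functions is convex. -/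
theorem convexOn_iSup_affine {ι : Type*} [Nonempty ι] (a b : ι → ℝ)
    (hbdd : ∀ y, BddAbove (range fun i => a i + b i * y)) :
    ConvexOn ℝ univ fun y => ⨆ i, (a i + b i * y) := by
  refine ⟨convex_univ, fun x _ y _ s t hs ht hst => ciSup_le fun i => ?_⟩
  have h1 := le_ciSup (hbdd x) i
  have h2 := le_ciSup (hbdd y) i
  simp only [smul_eq_mul] at *
  calc a i + b i * (s * x + t * y) = (s + t) * a i + b i * (s * x + t * y) := by rw [hst, one_mul]
    _ = s * (a i + b i * x) + t * (a i + b i * y) := by ring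
    _ ≤ _ := add_le_add (mul_le_mul_of_nonneg_left h1 hs) (mul_le_mul_of_nonneg_left h2 ht)

/-! ### Strassen's theorem -/

/-- The positivity underlying Strassen's theorem. -/
theorem integral_add_integral_nonneg_of_convex_order {μ ν : Measure I} [IsFiniteMeasure μ]
    [IsFiniteMeasure ν]
    (hcx : ∀ c : ℝ → ℝ, ConvexOn ℝ univ c → ∫ y : I, c y ∂μ ≤ ∫ y : I, c y ∂ν)
    {f g h : I → ℝ} (hf : Continuous f) (hg : Continuous g) (hh : Continuous h)
    (hpos : ∀ x y : I, 0 ≤ f x + g y + h x * (y - x)) :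
    0 ≤ ∫ x, f x ∂μ + ∫ y, g y ∂ν := by
  have hbdd : ∀ y : ℝ, BddAbove (range fun x : I => (-f x + h x * x) + (-h x) * y) := fun y =>
    (isCompact_range (by fun_prop)).bddAbove
  have hconv := convexOn_iSup_affine _ _ hbdd
  -- `hpos` says `-f x - h x * (y - x) ≤ g y`. The supremum over `x` is a convex function squeezed
  -- between `-f` and `g`.
  set c : ℝ → ℝ := fun y => ⨆ x : I, ((-f x + h x * x) + (-h x) * y) with hc
  have hcont : Continuous c := by
    rw [← continuousOn_univ]
    exact hconv.continuousOn isOpen_univ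
  have hci : Continuous fun y : I => c y := hcont.comp continuous_subtype_val
  have h1 : ∀ y : I, c y ≤ g y := fun y => ciSup_le fun x => by linarith [hpos x y]
  have h2 : ∀ x : I, -f x ≤ c x := fun x => by
    have := le_ciSup (hbdd x) x
    simp only [hc]
    linarith
  have h3 : ∫ x, -f x ∂μ ≤ ∫ x : I, c x ∂μ :=
    integral_mono hf.neg.integrable_unitInterval hci.integrable_unitInterval h2
  have h4 : ∫ y : I, c y ∂ν ≤ ∫ y, g y ∂ν :=
    integral_mono hci.integrable_unitInterval hg.integrable_unitInterval h1
  rw [integral_neg] at h3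
  linarith [hcx c hconv]

/-- A positive linear functional on the continuous functions of a compact metrizable space is
given by a finite measure. -/
theorem exists_measure_of_nonneg {X : Type*} [TopologicalSpace X] [CompactSpace X] [T2Space X]
    [MeasurableSpace X] [BorelSpace X] (Λ : C(X, ℝ) →ₗ[ℝ] ℝ) (hΛ : ∀ f, 0 ≤ f → 0 ≤ Λ f) :
    ∃ J : Measure X, IsFiniteMeasure J ∧ ∀ f : C(X, ℝ), ∫ x, f x ∂J = Λ f := by
  let T : CompactlySupportedContinuousMap X ℝ →ₗ[ℝ] C(X, ℝ) :=
    { toFun := fun f => f.toContinuousMap, map_add' := fun _ _ => rfl, map_smul' := fun _ _ => rfl }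
  let Λ' : CompactlySupportedContinuousMap X ℝ →ₚ[ℝ] ℝ :=
    PositiveLinearMap.mk₀ (Λ ∘ₗ T) fun f hf => hΛ _ fun x => hf x
  refine ⟨RealRMK.rieszMeasure Λ', ⟨?_⟩, fun f => ?_⟩
  · exact isCompact_univ.measure_lt_top
  · exact RealRMK.integral_rieszMeasure Λ' (CompactlySupportedContinuousMap.continuousMapEquiv f)

/-- **Strassen's theorem** on the unit interval: two measures in the convex order are the marginals
of a martingale coupling. -/
theorem exists_martingale_coupling {μ ν : Measure I} [IsFiniteMeasure μ] [IsFiniteMeasure ν]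
    (hcx : ∀ c : ℝ → ℝ, ConvexOn ℝ univ c → ∫ y : I, c y ∂μ ≤ ∫ y : I, c y ∂ν) :
    ∃ J : Measure (I × I), IsFiniteMeasure J ∧ J.map Prod.fst = μ ∧ J.map Prod.snd = ν ∧
      ∀ h : C(I, ℝ), ∫ p, h p.1 * p.2 ∂J = ∫ p, h p.1 * p.1 ∂J := by
  let d : C(I × I, ℝ) := ⟨fun p => (p.2 : ℝ) - p.1, by fun_prop⟩
  let T : C(I, ℝ) × C(I, ℝ) × C(I, ℝ) →ₗ[ℝ] C(I × I, ℝ) :=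
    { toFun := fun v => v.1.comp ⟨Prod.fst, continuous_fst⟩ + v.2.1.comp ⟨Prod.snd, continuous_snd⟩
        + v.2.2.comp ⟨Prod.fst, continuous_fst⟩ * d
      map_add' := fun v w => by ext p; simp; ring
      map_smul' := fun a v => by ext p; simp }
  let l : C(I, ℝ) × C(I, ℝ) × C(I, ℝ) →ₗ[ℝ] ℝ :=
    { toFun := fun v => ∫ x, v.1 x ∂μ + ∫ y, v.2.1 y ∂ν
      map_add' := fun v w => by
        simp only [Prod.fst_add, Prod.snd_add, ContinuousMap.add_apply]
        rw [integral_add v.1.continuous.integrable_unitInterval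
          w.1.continuous.integrable_unitInterval, integral_add
          v.2.1.continuous.integrable_unitInterval w.2.1.continuous.integrable_unitInterval]
        ring
      map_smul' := fun a v => by
        simp [integral_const_mul, mul_add] }
  -- The goal is a positive functional on `C(I × I, ℝ)` sending `T v` to `l v`. Extending from pairs
  -- `(v, 0)`, with the cone `0 ≤ T v + F`, makes it unnecessary to check that `l` factors through
  -- `T`.
  let s : PointedCone ℝ ((C(I, ℝ) × C(I, ℝ) × C(I, ℝ)) × C(I × I, ℝ)) := PointedCone.comap
    (T.coprod LinearMap.id) (PointedCone.positive ℝ C(I × I, ℝ))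
  have hs : ∀ v F, (v, F) ∈ s ↔ 0 ≤ T v + F := fun v F => by simp [s]
  let D : Submodule ℝ ((C(I, ℝ) × C(I, ℝ) × C(I, ℝ)) × C(I × I, ℝ)) := LinearMap.ker (LinearMap.snd ℝ (C(I, ℝ) × C(I, ℝ) × C(I, ℝ)) C(I × I, ℝ))
  obtain ⟨Λ, hΛ, hpos⟩ := riesz_extension s ⟨D, l ∘ₗ LinearMap.fst ℝ (C(I, ℝ) × C(I, ℝ) × C(I, ℝ)) C(I × I, ℝ) ∘ₗ D.subtype⟩
    (by
      rintro ⟨⟨v, F⟩, hF⟩ hmem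
      have hF0 : F = 0 := hF
      subst hF0
      rw [hs, add_zero] at hmem
      exact integral_add_integral_nonneg_of_convex_order hcx v.1.continuous v.2.1.continuous
        v.2.2.continuous fun x y => hmem (x, y))
    (by
      rintro ⟨v, F⟩
      refine ⟨⟨((ContinuousMap.const I (‖T v + F‖), 0, 0), 0), rfl⟩, ?_⟩
      rw [Prod.mk_add_mk, hs, map_add, zero_add, add_assoc]
      intro p
      have h1 := (T v + F).norm_coe_le_norm p
      have h2 := neg_le_of_abs_le h1
      simp [T] at h2 ⊢
      linarith)
  -- Both `(v, -T v)` and its negative lie in the cone, so `Λ` vanishes there.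
  have hkill : ∀ v, Λ (0, T v) = l v := by
    intro v
    have h1 : 0 ≤ Λ (v, -T v) := hpos _ ((hs _ _).2 (by simp))
    have h2 : 0 ≤ Λ (-v, T v) := hpos _ ((hs _ _).2 (by simp))
    have h3 : Λ (v, 0) = l v := hΛ ⟨(v, 0), rfl⟩
    have h4 : Λ (v, -T v) = Λ (v, 0) - Λ (0, T v) := by rw [← map_sub]; simp
    have h5 : Λ (-v, T v) = Λ (0, T v) - Λ (v, 0) := by rw [← map_sub]; simp
    linarith
  obtain ⟨J, hJ, hJint⟩ := exists_measure_of_nonneg (Λ ∘ₗ LinearMap.inr ℝ (C(I, ℝ) × C(I, ℝ) × C(I, ℝ)) C(I × I, ℝ))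
    fun f hf => hpos _ ((hs _ _).2 (by simpa using hf))
  have key : ∀ v : C(I, ℝ) × C(I, ℝ) × C(I, ℝ), ∫ p, T v p ∂J = l v := fun v => by rw [hJint]; exact hkill v
  refine ⟨J, hJ, ?_, ?_, fun h => ?_⟩
  · refine ext_of_forall_integral_eq_of_IsFiniteMeasure fun f => ?_
    rw [integral_map measurable_fst.aemeasurable f.continuous.aestronglyMeasurable]
    simpa [T, l] using key (f.toContinuousMap, 0, 0)
  · refine ext_of_forall_integral_eq_of_IsFiniteMeasure fun f => ?_
    rw [integral_map measurable_snd.aemeasurable f.continuous.aestronglyMeasurable]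
    simpa [T, l] using key (0, f.toContinuousMap, 0)
  · have hi : ∀ {f : I × I → ℝ}, Continuous f → Integrable f J := fun hf =>
      hf.integrable_of_hasCompactSupport (HasCompactSupport.of_compactSpace _)
    have h0 : ∫ p, (h p.1 * p.2 - h p.1 * p.1) ∂J = 0 := by
      simpa [T, l, d, mul_sub] using key (0, 0, h)
    rw [integral_sub (hi (by fun_prop)) (hi (by fun_prop))] at h0
    linarith

/-! ### Dichotomy laws and the kernel from a coupling -/

/-- The laws on the unit interval of the density of `Q` with respect to `P + Q` under `P + Q`. -/
structure IsDichotomyLaw (μ : Measure I) : Prop where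
  mass : μ univ = 2
  mean : ∫⁻ y : I, ENNReal.ofReal y ∂μ = 1

namespace IsDichotomyLaw

variable {μ ν : Measure I}

theorem isFiniteMeasure (hμ : IsDichotomyLaw μ) : IsFiniteMeasure μ :=
  ⟨by rw [hμ.mass]; exact ENNReal.ofNat_lt_top⟩

theorem real_univ (hμ : IsDichotomyLaw μ) : μ.real univ = 2 := by
  simp [Measure.real, hμ.mass]

theorem integral_eq (hμ : IsDichotomyLaw μ) : ∫ y : I, (y : ℝ) ∂μ = 1 := by
  rw [integral_eq_lintegral_of_nonneg_ae (.of_forall fun y => y.2.1)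
    (by fun_prop : Continuous _).aestronglyMeasurable, hμ.mean, ENNReal.toReal_one]

theorem of_real [IsFiniteMeasure μ] (hm : μ.real univ = 2) (hb : ∫ y : I, (y : ℝ) ∂μ = 1) :
    IsDichotomyLaw μ where
  mass := by
    rw [← ENNReal.ofReal_toReal (measure_ne_top μ univ)]
    change ENNReal.ofReal (μ.real univ) = 2
    simp [hm]
  mean := by
    rw [← ofReal_integral_eq_lintegral_ofReal (by fun_prop : Continuous _).integrable_unitInterval
      (.of_forall fun y => y.2.1), hb, ENNReal.ofReal_one]

theorem lintegral_one_sub (hμ : IsDichotomyLaw μ) :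
    ∫⁻ y : I, ENNReal.ofReal (1 - y) ∂μ = 1 := by
  have := hμ.isFiniteMeasure
  rw [← ofReal_integral_eq_lintegral_ofReal (by fun_prop : Continuous _).integrable_unitInterval
      (.of_forall fun y => sub_nonneg.2 y.2.2), integral_sub
      (by fun_prop : Continuous _).integrable_unitInterval
      (by fun_prop : Continuous _).integrable_unitInterval, hμ.integral_eq]
  simp only [integral_const, smul_eq_mul, mul_one, hμ.real_univ]
  norm_num

/-- The testing problem on the unit interval with a given law of the density of `Q`. -/
noncomputable def testingPair (hμ : IsDichotomyLaw μ) : TestingPair where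
  Ω := I
  mΩ := inferInstance
  P := μ.withDensity fun y => ENNReal.ofReal (1 - y)
  Q := μ.withDensity fun y => ENNReal.ofReal y
  probP := ⟨by rw [withDensity_apply _ .univ, Measure.restrict_univ, hμ.lintegral_one_sub]⟩
  probQ := ⟨by rw [withDensity_apply _ .univ, Measure.restrict_univ, hμ.mean]⟩

end IsDichotomyLaw

/-- The kernel is the conditional law under `J` of the first coordinate given the second. It carries
`w ν` to the first marginal of `w(p.2) J`; by `hJ`, `w(p.2)` has conditional expectation `w(p.1)`
given `p.1`, so this marginal is `w μ`. -/
theorem withDensity_bind_condKernel {μ ν : Measure I} [IsFiniteMeasure μ] [IsFiniteMeasure ν]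
    {J : Measure (I × I)} [IsFiniteMeasure J] (h1 : J.map Prod.fst = μ) (h2 : J.map Prod.snd = ν)
    {w : I → ℝ} (hw : Continuous w) (hw0 : ∀ y, 0 ≤ w y)
    (hJ : ∀ h : C(I, ℝ), ∫ p, h p.1 * w p.2 ∂J = ∫ p, h p.1 * w p.1 ∂J) :
    (ν.withDensity fun y => ENNReal.ofReal (w y)).bind (J.map Prod.swap).condKernel =
      μ.withDensity fun y => ENNReal.ofReal (w y) := by
  have hwm : Measurable fun y => ENNReal.ofReal (w y) := hw.measurable.ennreal_ofReal
  have hi : ∀ {f : I × I → ℝ}, Continuous f → Integrable f J := fun hf =>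
    hf.integrable_of_hasCompactSupport (HasCompactSupport.of_compactSpace _)
  have hfin : ∀ {f : I × I → ℝ}, Continuous f →
      IsFiniteMeasure (J.withDensity fun p => ENNReal.ofReal (f p)) := fun hf =>
    isFiniteMeasure_withDensity_ofReal (hi hf).2
  have hsnd : Continuous fun p : I × I => w p.2 := hw.comp continuous_snd
  have hfst : Continuous fun p : I × I => w p.1 := hw.comp continuous_fst
  have := hfin hsnd
  have := hfin hfst
  have heq : (J.withDensity fun p => ENNReal.ofReal (w p.2)).map Prod.fst =
      (J.withDensity fun p => ENNReal.ofReal (w p.1)).map Prod.fst := by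
    refine ext_of_forall_integral_eq_of_IsFiniteMeasure fun f => ?_
    rw [integral_map measurable_fst.aemeasurable f.continuous.aestronglyMeasurable,
      integral_map measurable_fst.aemeasurable f.continuous.aestronglyMeasurable,
      integral_withDensity_eq_integral_toReal_smul hsnd.measurable.ennreal_ofReal
        (.of_forall fun _ => ENNReal.ofReal_lt_top),
      integral_withDensity_eq_integral_toReal_smul hfst.measurable.ennreal_ofReal
        (.of_forall fun _ => ENNReal.ofReal_lt_top)]
    simpa [ENNReal.toReal_ofReal (hw0 _), mul_comm] using hJ f.toContinuousMap
  have hswap : (J.map Prod.swap).fst = ν := by rw [Measure.fst_map_swap, Measure.snd, h2]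
  have hdis : ν ⊗ₘ (J.map Prod.swap).condKernel = J.map Prod.swap := by
    rw [← hswap]; exact Measure.disintegrate _ _
  ext A hA
  have e2 := congrArg (fun m => m A) heq
  simp only [Measure.map_apply measurable_fst hA, withDensity_apply _ (measurable_fst hA)] at e2
  have e1 : ∫⁻ p in Prod.fst ⁻¹' A, ENNReal.ofReal (w p.1) ∂J =
      (μ.withDensity fun y => ENNReal.ofReal (w y)) A := by
    rw [withDensity_apply _ hA, ← h1, setLIntegral_map hA hwm measurable_fst]
  rw [← e1, ← e2, Measure.bind_apply hA (Kernel.aemeasurable _),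
    lintegral_withDensity_eq_lintegral_mul _ hwm (Kernel.measurable_coe _ hA)]
  have e3 : ∫⁻ p in Prod.fst ⁻¹' A, ENNReal.ofReal (w p.2) ∂J =
      ∫⁻ q in univ ×ˢ A, ENNReal.ofReal (w q.1) ∂(J.map Prod.swap) := by
    rw [setLIntegral_map (f := fun q : I × I => ENNReal.ofReal (w q.1))
      (MeasurableSet.univ.prod hA) (hwm.comp measurable_fst) measurable_swap]
    congr 2
    ext p; simp
  rw [e3]
  conv_rhs => rw [← hdis]
  rw [Measure.setLIntegral_compProd (f := fun q : I × I => ENNReal.ofReal (w q.1))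
    (hwm.comp measurable_fst) .univ hA]
  simp

/-- The densities `1 - y` and `y` are affine, so the martingale property makes one kernel serve both
distributions. -/
theorem IsDichotomyLaw.blackwellLE {μ ν : Measure I} (hμ : IsDichotomyLaw μ)
    (hν : IsDichotomyLaw ν) (hpot : ∀ t ∈ Ioo (0 : ℝ) 1, potential μ t ≤ potential ν t) :
    hμ.testingPair.BlackwellLE hν.testingPair := by
  have := hμ.isFiniteMeasure
  have := hν.isFiniteMeasure
  obtain ⟨J, hJ, h1, h2, hmart⟩ := exists_martingale_coupling fun c hc =>
    integral_convex_le_of_potential_le (hμ.real_univ.trans hν.real_univ.symm)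
      (hμ.integral_eq.trans hν.integral_eq.symm) hpot hc
  have hi : ∀ {f : I × I → ℝ}, Continuous f → Integrable f J := fun hf =>
    hf.integrable_of_hasCompactSupport (HasCompactSupport.of_compactSpace _)
  have hk : IsMarkovKernel (J.map Prod.swap).condKernel := inferInstance
  refine ⟨(J.map Prod.swap).condKernel, hk, ?_, ?_⟩
  · refine (withDensity_bind_condKernel h1 h2 (w := fun y => 1 - y) (by fun_prop)
      (fun y => sub_nonneg.2 y.2.2) fun h => ?_).symm
    simp_rw [mul_sub]
    rw [integral_sub (hi (by fun_prop)) (hi (by fun_prop)), integral_sub (hi (by fun_prop))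
      (hi (by fun_prop)), hmart]
  · exact (withDensity_bind_condKernel h1 h2 (w := fun y => y) (by fun_prop)
      (fun y => y.2.1) hmart).symm

/-- The potential determines the law. -/
theorem IsDichotomyLaw.eq_of_potential_eq {μ ν : Measure I} (hμ : IsDichotomyLaw μ)
    (hν : IsDichotomyLaw ν) (hpot : ∀ t ∈ Ioo (0 : ℝ) 1, potential μ t = potential ν t) :
    μ = ν := by
  have := hμ.isFiniteMeasure
  have := hν.isFiniteMeasure
  have hcx : ∀ c : ℝ → ℝ, ConvexOn ℝ univ c → ∫ y : I, c y ∂μ = ∫ y : I, c y ∂ν := fun c hc =>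
    le_antisymm
      (integral_convex_le_of_potential_le (hμ.real_univ.trans hν.real_univ.symm)
        (hμ.integral_eq.trans hν.integral_eq.symm) (fun t ht => (hpot t ht).le) hc)
      (integral_convex_le_of_potential_le (hν.real_univ.trans hμ.real_univ.symm)
        (hν.integral_eq.trans hμ.integral_eq.symm) (fun t ht => (hpot t ht).ge) hc)
  -- All real `t` are needed, because the difference quotients below may leave `(0, 1)`.
  have hpot' : ∀ t, potential μ t = potential ν t := fun t =>
    hcx (fun y => max (t - y) 0) <| ConvexOn.sup
      ((convexOn_const t convex_univ).sub (concaveOn_id convex_univ)) (convexOn_const 0 convex_univ)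
  refine Measure.ext_of_Iic μ ν fun a => ?_
  -- The right derivative of the potential is the distribution function.
  have key : ∀ ρ : Measure I, IsFiniteMeasure ρ → Filter.Tendsto
      (fun n : ℕ => (n + 1 : ℝ) * (potential ρ (a + 1 / (n + 1)) - potential ρ a)) Filter.atTop
      (nhds (ρ.real (Iic a))) := by
    intro ρ _
    have e : ∀ n : ℕ, (n + 1 : ℝ) * (potential ρ (a + 1 / (n + 1)) - potential ρ a) =
        ∫ y : I, (n + 1 : ℝ) * (max ((a : ℝ) + 1 / (n + 1) - y) 0 - max ((a : ℝ) - y) 0) ∂ρ :=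
      fun n => by
        rw [integral_const_mul, integral_sub (by fun_prop : Continuous _).integrable_unitInterval
          (by fun_prop : Continuous _).integrable_unitInterval, potential, potential]
    simp_rw [e]
    rw [← integral_indicator_one measurableSet_Iic]
    refine tendsto_integral_of_dominated_convergence (fun _ => 1)
      (fun n => (by fun_prop : Continuous _).aestronglyMeasurable) (integrable_const _)
      (fun n => .of_forall fun y => ?_) (.of_forall fun y => ?_)
    · have hn : (0 : ℝ) < n + 1 := by positivity
      have h1 : max ((a : ℝ) + 1 / (n + 1) - y) 0 - max ((a : ℝ) - y) 0 ≤ 1 / (n + 1) := by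
        have : (0 : ℝ) < 1 / (n + 1) := by positivity
        rw [sub_le_iff_le_add]
        refine max_le ?_ ?_ <;> linarith [le_max_left ((a : ℝ) - y) 0, le_max_right ((a : ℝ) - y) 0]
      have h0 : 0 ≤ max ((a : ℝ) + 1 / (n + 1) - y) 0 - max ((a : ℝ) - y) 0 := by
        have : (0 : ℝ) < 1 / (n + 1) := by positivity
        exact sub_nonneg.2 (max_le_max (by linarith) le_rfl)
      rw [Real.norm_of_nonneg (by positivity)]
      calc _ ≤ (n + 1 : ℝ) * (1 / (n + 1)) := mul_le_mul_of_nonneg_left h1 hn.le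
        _ = 1 := by field_simp
    · by_cases hya : y ≤ a
      · have hya' : (y : ℝ) ≤ a := hya
        rw [indicator_of_mem (mem_Iic.2 hya)]
        refine tendsto_const_nhds.congr fun n => ?_
        have hn : (0 : ℝ) < n + 1 := by positivity
        have : (0 : ℝ) < 1 / (n + 1) := by positivity
        rw [max_eq_left (by linarith), max_eq_left (by linarith)]
        field_simp
        simp
        ring
      · have hya' : (a : ℝ) < y := not_le.1 hya
        rw [indicator_of_notMem (by simpa using hya)]
        refine tendsto_const_nhds.congr' ?_
        filter_upwards [(tendsto_one_div_add_atTop_nhds_zero_nat (𝕜 := ℝ)).eventually_lt_const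
          (sub_pos.2 hya')] with n hn
        rw [max_eq_right (by linarith), max_eq_right (by linarith)]
        simp
  have h := tendsto_nhds_unique (key μ inferInstance)
    (by simpa only [hpot'] using key ν inferInstance)
  exact (measureReal_eq_measureReal_iff).1 h

/-! ### Hockey-stick curves as potentials -/

namespace TestingPair

/-- `y` is a version of the density of `Q` with respect to `P + Q`. -/
structure HasDensity (E : TestingPair) (y : E.Ω → I) : Prop where
  measurable : Measurable y
  eqP : E.P = (E.P + E.Q).withDensity fun ω => ENNReal.ofReal (1 - y ω)
  eqQ : E.Q = (E.P + E.Q).withDensity fun ω => ENNReal.ofReal (y ω)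

theorem exists_hasDensity (E : TestingPair) : ∃ y : E.Ω → I, E.HasDensity y := by
  have hQ : E.Q ≪ E.P + E.Q := Measure.absolutelyContinuous_of_le (Measure.le_add_left le_rfl)
  have hP : E.P ≪ E.P + E.Q := Measure.AbsolutelyContinuous.rfl.add_right _
  have hm : Measurable (E.Q.rnDeriv (E.P + E.Q)) := Measure.measurable_rnDeriv _ _
  have hsum : ∀ᵐ ω ∂(E.P + E.Q),
      E.P.rnDeriv (E.P + E.Q) ω + E.Q.rnDeriv (E.P + E.Q) ω = 1 := by
    filter_upwards [Measure.rnDeriv_add E.P E.Q (E.P + E.Q), Measure.rnDeriv_self (E.P + E.Q)]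
      with ω h1 h2
    rw [← h2, h1, Pi.add_apply]
  have hy : ∀ᵐ ω ∂(E.P + E.Q),
      (E.Q.rnDeriv (E.P + E.Q) ω).toReal ∈ Icc (0 : ℝ) 1 ∧ E.Q.rnDeriv (E.P + E.Q) ω ≠ ⊤ := by
    filter_upwards [hsum] with ω h
    have h1 : E.Q.rnDeriv (E.P + E.Q) ω ≤ 1 := h ▸ le_add_self
    exact ⟨⟨ENNReal.toReal_nonneg, by simpa using ENNReal.toReal_mono ENNReal.one_ne_top h1⟩,
      (h1.trans_lt ENNReal.one_lt_top).ne⟩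
  -- The projection changes the density only on a null set and puts its values in `I` everywhere.
  refine ⟨fun ω => projIcc 0 1 zero_le_one (E.Q.rnDeriv (E.P + E.Q) ω).toReal,
    continuous_projIcc.measurable.comp hm.ennreal_toReal, ?_, ?_⟩
  · conv_lhs => rw [← Measure.withDensity_rnDeriv_eq _ _ hP]
    refine withDensity_congr_ae ?_
    filter_upwards [hsum, hy] with ω h1 h2
    rw [projIcc_of_mem _ h2.1, ENNReal.ofReal_sub _ ENNReal.toReal_nonneg,
      ENNReal.ofReal_toReal h2.2, ENNReal.ofReal_one, ← h1, ENNReal.add_sub_cancel_right h2.2]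
  · conv_lhs => rw [← Measure.withDensity_rnDeriv_eq _ _ hQ]
    refine withDensity_congr_ae ?_
    filter_upwards [hy] with ω h2
    rw [projIcc_of_mem _ h2.1, ENNReal.ofReal_toReal h2.2]

/-- The law of the density `y` under `P + Q`. -/
noncomputable def lawOf (E : TestingPair) (y : E.Ω → I) : Measure I := (E.P + E.Q).map y

namespace HasDensity

variable {E : TestingPair} {y : E.Ω → I}

theorem measurable_coe (h : E.HasDensity y) : Measurable fun ω => (y ω : ℝ) :=
  measurable_subtype_coe.comp h.measurable

theorem lintegral_Q (h : E.HasDensity y) {f : E.Ω → ENNReal} (hf : Measurable f) :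
    ∫⁻ ω, f ω ∂E.Q = ∫⁻ ω, ENNReal.ofReal (y ω) * f ω ∂(E.P + E.Q) := by
  conv_lhs => rw [h.eqQ]
  exact lintegral_withDensity_eq_lintegral_mul _ h.measurable_coe.ennreal_ofReal hf

theorem integral_P (h : E.HasDensity y) (f : E.Ω → ℝ) :
    ∫ ω, f ω ∂E.P = ∫ ω, (1 - y ω) * f ω ∂(E.P + E.Q) := by
  conv_lhs => rw [h.eqP]
  rw [integral_withDensity_eq_integral_toReal_smul (h.measurable_coe.const_sub 1).ennreal_ofReal
    (.of_forall fun _ => ENNReal.ofReal_lt_top)]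
  simp [ENNReal.toReal_ofReal (sub_nonneg.2 (y _).2.2)]

theorem integral_Q (h : E.HasDensity y) (f : E.Ω → ℝ) :
    ∫ ω, f ω ∂E.Q = ∫ ω, y ω * f ω ∂(E.P + E.Q) := by
  conv_lhs => rw [h.eqQ]
  rw [integral_withDensity_eq_integral_toReal_smul h.measurable_coe.ennreal_ofReal
    (.of_forall fun _ => ENNReal.ofReal_lt_top)]
  simp [ENNReal.toReal_ofReal (y _).2.1]

theorem isDichotomyLaw (h : E.HasDensity y) : IsDichotomyLaw (E.lawOf y) where
  mass := by
    rw [lawOf, Measure.map_apply h.measurable .univ]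
    simp [one_add_one_eq_two]
  mean := by
    rw [lawOf, lintegral_map (by fun_prop) h.measurable]
    simpa using (h.lintegral_Q measurable_one).symm

theorem likelihoodRatio_ae_eq (h : E.HasDensity y) :
    E.likelihoodRatio =ᵐ[E.P] fun ω => ENNReal.ofReal (1 - y ω) / ENNReal.ofReal (y ω) := by
  have hP : E.P ≪ E.P + E.Q := Measure.AbsolutelyContinuous.rfl.add_right _
  have h1 : E.P.rnDeriv (E.P + E.Q) =ᵐ[E.P + E.Q] fun ω => ENNReal.ofReal (1 - y ω) := by
    have := Measure.rnDeriv_withDensity (E.P + E.Q) (h.measurable_coe.const_sub 1).ennreal_ofReal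
    rwa [← h.eqP] at this
  have h2 : E.Q.rnDeriv (E.P + E.Q) =ᵐ[E.P + E.Q] fun ω => ENNReal.ofReal (y ω) := by
    have := Measure.rnDeriv_withDensity (E.P + E.Q) h.measurable_coe.ennreal_ofReal
    rwa [← h.eqQ] at this
  refine hP.ae_le ?_
  filter_upwards [h1, h2] with ω e1 e2
  rw [likelihoodRatio, e1, e2]

theorem privacyLossLaw_eq_map (h : E.HasDensity y) : E.privacyLossLaw =
    E.P.map fun ω => ENNReal.log (ENNReal.ofReal (1 - y ω) / ENNReal.ofReal (y ω)) := by
  refine Measure.map_congr ?_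
  filter_upwards [h.likelihoodRatio_ae_eq] with ω e
  rw [e]

theorem measurable_log_ratio :
    Measurable fun t : I => ENNReal.log (ENNReal.ofReal (1 - t) / ENNReal.ofReal t) :=
  ENNReal.measurable_log.comp (by fun_prop)

theorem measurable_log_ratio_comp (h : E.HasDensity y) : Measurable fun ω =>
    ENNReal.log (ENNReal.ofReal (1 - y ω) / ENNReal.ofReal (y ω)) :=
  measurable_log_ratio.comp h.measurable

/-- This shows that the PLD depends only on the law of `y`. -/
theorem privacyLossLaw_eq (h : E.HasDensity y) : E.privacyLossLaw =
    ((E.lawOf y).withDensity fun t => ENNReal.ofReal (1 - t)).map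
      fun t : I => ENNReal.log (ENNReal.ofReal (1 - t) / ENNReal.ofReal t) := by
  have hw : Measurable fun t : I => ENNReal.ofReal (1 - t) := by fun_prop
  rw [h.privacyLossLaw_eq_map]
  ext A hA
  have hB := measurable_log_ratio hA
  rw [Measure.map_apply measurable_log_ratio hA, withDensity_apply _ hB, lawOf,
    setLIntegral_map hB hw h.measurable,
    Measure.map_apply h.measurable_log_ratio_comp hA]
  conv_lhs => rw [h.eqP]
  rw [withDensity_apply _ (h.measurable_log_ratio_comp hA)]
  rfl

theorem integral_max_eq (h : E.HasDensity y) {x : ℝ} (hx : 0 < x) :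
    ∫ ω, max (1 - (1 + x) * y ω) 0 ∂(E.P + E.Q) =
      (1 + x) * potential (E.lawOf y) (1 / (1 + x)) := by
  have hx1 : 0 < 1 + x := by linarith
  rw [potential, lawOf, integral_map h.measurable.aemeasurable
    (by fun_prop : Continuous _).aestronglyMeasurable, ← integral_const_mul]
  refine integral_congr_ae (.of_forall fun ω => ?_)
  simp only
  rw [mul_max_of_nonneg _ _ hx1.le]
  congr 1
  · field_simp
  · simp

theorem integrable_bdd (E : TestingPair) {f : E.Ω → ℝ} (hf : Measurable f) {C : ℝ}
    (hC : ∀ ω, |f ω| ≤ C) : Integrable f (E.P + E.Q) :=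
  Integrable.of_bound hf.aestronglyMeasurable C (.of_forall hC)

theorem integral_sub_eq (h : E.HasDensity y) {φ : E.Ω → ℝ} (hφ : Measurable φ)
    (h01 : ∀ ω, φ ω ∈ Icc (0 : ℝ) 1) (x : ℝ) :
    ∫ ω, φ ω ∂E.P - x * ∫ ω, φ ω ∂E.Q = ∫ ω, φ ω * (1 - (1 + x) * y ω) ∂(E.P + E.Q) := by
  have hm := h.measurable_coe
  rw [h.integral_P, h.integral_Q, ← integral_const_mul, ← integral_sub]
  · congr 1; ext ω; ring
  · refine integrable_bdd E (by fun_prop) (C := 1) fun ω => ?_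
    have h1 := (y ω).2; have h2 := h01 ω
    rw [abs_of_nonneg (mul_nonneg (sub_nonneg.2 h1.2) h2.1)]
    exact mul_le_one₀ (by linarith [h1.1]) h2.1 h2.2
  · refine Integrable.const_mul (integrable_bdd E (by fun_prop) (C := 1) fun ω => ?_) x
    have h1 := (y ω).2; have h2 := h01 ω
    rw [abs_of_nonneg (mul_nonneg h1.1 h2.1)]
    exact mul_le_one₀ h1.2 h2.1 h2.2

/-- Neyman–Pearson: `φ z ≤ z₊` pointwise for the density `z = 1 - (1+x)y` of `P - xQ`, with equality
for the indicator of `z ≥ 0`. Data processing and the duality with tradeoff curves need randomized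
tests. -/
theorem integral_sub_le (h : E.HasDensity y) {φ : E.Ω → ℝ} (hφ : Measurable φ)
    (h01 : ∀ ω, φ ω ∈ Icc (0 : ℝ) 1) {x : ℝ} (hx : 0 < x) :
    ∫ ω, φ ω ∂E.P - x * ∫ ω, φ ω ∂E.Q ≤ (1 + x) * potential (E.lawOf y) (1 / (1 + x)) := by
  have hm := h.measurable_coe
  rw [h.integral_sub_eq hφ h01, ← h.integral_max_eq hx]
  have hb : ∀ ω, |1 - (1 + x) * (y ω : ℝ)| ≤ 1 + x := fun ω => by
    have h1 := (y ω).2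
    rw [abs_le]
    constructor <;> nlinarith [h1.1, h1.2]
  refine integral_mono (integrable_bdd E (by fun_prop) (C := 1 + x) fun ω => ?_)
    (integrable_bdd E (by fun_prop) (C := 1 + x) fun ω => ?_) fun ω => ?_
  · rw [abs_mul, abs_of_nonneg (h01 ω).1]
    exact (mul_le_of_le_one_left (abs_nonneg _) (h01 ω).2).trans (hb ω)
  · rw [abs_of_nonneg (le_max_right _ _)]
    exact max_le ((le_abs_self _).trans (hb ω)) (by linarith)
  · rcases le_total 0 (1 - (1 + x) * (y ω : ℝ)) with h0 | h0
    · exact (mul_le_of_le_one_left h0 (h01 ω).2).trans (le_max_left _ _)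
    · exact (mul_nonpos_of_nonneg_of_nonpos (h01 ω).1 h0).trans (le_max_right _ _)

theorem real_sub_eq (h : E.HasDensity y) {x : ℝ} (hx : 0 < x) :
    E.P.real {ω | (1 + x) * (y ω : ℝ) ≤ 1} - x * E.Q.real {ω | (1 + x) * (y ω : ℝ) ≤ 1} =
      (1 + x) * potential (E.lawOf y) (1 / (1 + x)) := by
  have hm := h.measurable_coe
  have hA : MeasurableSet {ω | (1 + x) * (y ω : ℝ) ≤ 1} :=
    measurableSet_le (by fun_prop) measurable_const
  rw [← integral_indicator_one hA, ← integral_indicator_one hA,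
    h.integral_sub_eq (measurable_one.indicator hA), ← h.integral_max_eq hx]
  · refine integral_congr_ae (.of_forall fun ω => ?_)
    by_cases hω : ω ∈ {ω | (1 + x) * (y ω : ℝ) ≤ 1}
    · have hω' : (1 + x) * (y ω : ℝ) ≤ 1 := hω
      simp only [indicator_of_mem hω]
      rw [max_eq_left (by linarith)]; simp
    · have hω' : ¬ (1 + x) * (y ω : ℝ) ≤ 1 := hω
      simp only [indicator_of_notMem hω]
      rw [max_eq_right (by linarith)]; simp
  · intro ω
    by_cases hω : ω ∈ {ω | (1 + x) * (y ω : ℝ) ≤ 1} <;> simp [hω]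

theorem isGreatest_hockeyStick (h : E.HasDensity y) {x : ℝ} (hx : 0 < x) :
    IsGreatest {z | ∃ A : Set E.Ω, MeasurableSet A ∧ z = E.P.real A - x * E.Q.real A}
      ((1 + x) * potential (E.lawOf y) (1 / (1 + x))) := by
  have hm := h.measurable_coe
  refine ⟨⟨_, measurableSet_le (by fun_prop) measurable_const, (h.real_sub_eq hx).symm⟩, ?_⟩
  rintro _ ⟨A, hA, rfl⟩
  rw [← integral_indicator_one hA, ← integral_indicator_one hA]
  refine h.integral_sub_le (measurable_one.indicator hA) (fun ω => ?_) hx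
  by_cases hω : ω ∈ A <;> simp [hω]

theorem hockeyStick_eq (h : E.HasDensity y) {x : ℝ} (hx : 0 < x) :
    E.hockeyStick x = (1 + x) * potential (E.lawOf y) (1 / (1 + x)) :=
  (h.isGreatest_hockeyStick hx).csSup_eq

/-- Here `e^{-Z} = y/(1-y)`, and the density `1 - y` of `P` turns `(1 - x e^{-Z})₊` into `(1 -
(1+x)y)₊`. -/
theorem pld_hockeyStick_eq (h : E.HasDensity y) {x : ℝ} (hx : 0 < x) :
    E.pld.hockeyStick x = (1 + x) * potential (E.lawOf y) (1 / (1 + x)) := by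
  have hmeas : Measurable fun z : EReal => (1 - ENNReal.ofReal x * EReal.exp (-z)).toReal := by
    have := EReal.measurable_exp
    fun_prop
  have h1 : E.pld.hockeyStick x =
      ∫ z, (1 - ENNReal.ofReal x * EReal.exp (-z)).toReal ∂E.privacyLossLaw := rfl
  rw [h1, h.privacyLossLaw_eq_map, integral_map
    h.measurable_log_ratio_comp.aemeasurable hmeas.aestronglyMeasurable,
    h.integral_P, ← h.integral_max_eq hx]
  refine integral_congr_ae (.of_forall fun ω => ?_)
  have hy := (y ω).2
  simp only
  rw [← ENNReal.log_inv, ENNReal.exp_log]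
  rcases hy.2.lt_or_eq with hlt | heq
  · have h1y : 0 < 1 - (y ω : ℝ) := sub_pos.2 hlt
    rw [ENNReal.inv_div (.inl ENNReal.ofReal_ne_top) (.inr (by simpa using h1y)),
      ← ENNReal.ofReal_div_of_pos h1y, ← ENNReal.ofReal_mul hx.le, ← ENNReal.ofReal_one,
      ← ENNReal.ofReal_sub _ (by have := hy.1; positivity), ENNReal.toReal_ofReal',
      mul_max_of_nonneg _ _ h1y.le, mul_zero]
    congr 1
    field_simp
    ring
  -- At `y = 1` the ratio `y/(1-y)` is infinite, but both sides are `0`.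
  · rw [heq]
    simp [hx.le]

end HasDensity

theorem hockeyStick_eq_pld (E : TestingPair) {x : ℝ} (hx : 0 < x) :
    E.hockeyStick x = E.pld.hockeyStick x := by
  obtain ⟨y, h⟩ := E.exists_hasDensity
  rw [h.hockeyStick_eq hx, h.pld_hockeyStick_eq hx]

/-- The hockey-stick divergence bounds the difference over randomized events. -/
theorem integral_sub_le_hockeyStick (E : TestingPair) {φ : E.Ω → ℝ} (hφ : Measurable φ)
    (h01 : ∀ ω, φ ω ∈ Icc (0 : ℝ) 1) {x : ℝ} (hx : 0 < x) :
    ∫ ω, φ ω ∂E.P - x * ∫ ω, φ ω ∂E.Q ≤ E.hockeyStick x := by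
  obtain ⟨y, h⟩ := E.exists_hasDensity
  rw [h.hockeyStick_eq hx]
  exact h.integral_sub_le hφ h01 hx

/-- The data processing inequality for hockey-stick divergences. -/
theorem BlackwellLE.hockeyStick_le {E E' : TestingPair} (h : E.BlackwellLE E') {x : ℝ}
    (hx : 0 < x) : E.hockeyStick x ≤ E'.hockeyStick x := by
  obtain ⟨κ, hκ, hP, hQ⟩ := h
  refine csSup_le ⟨_, ∅, .empty, rfl⟩ ?_
  rintro _ ⟨A, hA, rfl⟩
  -- An event `A` pulls back through the kernel to the randomized test `ω ↦ κ ω A`.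
  have key : ∀ (R : Measure E.Ω) (S : Measure E'.Ω), R = S.bind κ →
      R.real A = ∫ ω, (κ ω).real A ∂S := by
    intro R S hR
    rw [hR, Measure.real, Measure.bind_apply hA (Kernel.aemeasurable _)]
    exact (integral_toReal (Kernel.measurable_coe _ hA).aemeasurable
      (.of_forall fun ω => measure_lt_top _ _)).symm
  rw [key _ _ hP, key _ _ hQ]
  exact E'.integral_sub_le_hockeyStick (Kernel.measurable_coe _ hA).ennreal_toReal
    (fun ω => ⟨measureReal_nonneg, measureReal_le_one⟩) hx

end TestingPair

/-! ### Canonical representatives and Blackwell's theorem -/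

theorem IsDichotomyLaw.add_eq {μ : Measure I} (hμ : IsDichotomyLaw μ) :
    hμ.testingPair.P + hμ.testingPair.Q = μ := by
  have h1 : (fun y : I => ENNReal.ofReal (1 - y)) + (fun y : I => ENNReal.ofReal y) = 1 := by
    ext y
    rw [Pi.add_apply, ← ENNReal.ofReal_add (sub_nonneg.2 y.2.2) y.2.1]
    simp
  change (μ.withDensity fun y => ENNReal.ofReal (1 - y)) + (μ.withDensity fun y => ENNReal.ofReal y)
    = μ
  rw [← withDensity_add_left (by fun_prop), h1, withDensity_one]

theorem IsDichotomyLaw.hasDensity {μ : Measure I} (hμ : IsDichotomyLaw μ) :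
    hμ.testingPair.HasDensity fun y => y where
  measurable := measurable_id
  eqP := by rw [hμ.add_eq]; rfl
  eqQ := by rw [hμ.add_eq]; rfl

theorem IsDichotomyLaw.lawOf_eq {μ : Measure I} (hμ : IsDichotomyLaw μ) :
    hμ.testingPair.lawOf (fun y => y) = μ :=
  (congrArg (Measure.map id) hμ.add_eq).trans Measure.map_id

/-- Passing to the law of `y` keeps the PLD, so questions about PLDs become questions about measures
on `I`. -/
theorem PLD.exists_isDichotomyLaw (L : PLD) :
    ∃ (μ : Measure I) (hμ : IsDichotomyLaw μ), hμ.testingPair.pld = L := by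
  obtain ⟨_, E, rfl⟩ := L
  obtain ⟨y, h⟩ := E.exists_hasDensity
  refine ⟨E.lawOf y, h.isDichotomyLaw, Subtype.ext ?_⟩
  change TestingPair.privacyLossLaw _ = E.privacyLossLaw
  rw [h.isDichotomyLaw.hasDensity.privacyLossLaw_eq, h.privacyLossLaw_eq,
    h.isDichotomyLaw.lawOf_eq]

theorem IsDichotomyLaw.pld_hockeyStick {μ : Measure I} (hμ : IsDichotomyLaw μ) {x : ℝ}
    (hx : 0 < x) : hμ.testingPair.pld.hockeyStick x = (1 + x) * potential μ (1 / (1 + x)) := by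
  rw [hμ.hasDensity.pld_hockeyStick_eq hx, hμ.lawOf_eq]

theorem IsDichotomyLaw.potential_eq {μ : Measure I} (hμ : IsDichotomyLaw μ) {t : ℝ}
    (ht : t ∈ Ioo (0 : ℝ) 1) :
    potential μ t = t * hμ.testingPair.pld.hockeyStick (1 / t - 1) := by
  have hx : 0 < 1 / t - 1 := sub_pos.2 (one_lt_one_div ht.1 ht.2)
  have h0 := ht.1.ne'
  rw [hμ.pld_hockeyStick hx, add_sub_cancel, one_div_one_div, ← mul_assoc, mul_one_div_cancel h0,
    one_mul]

namespace PLD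

/-- Blackwell's theorem for dichotomies: the order on privacy loss distributions is the pointwise
order of the hockey-stick curves. -/
theorem le_iff_hockeyStick_le {L L' : PLD} :
    L ≤ L' ↔ ∀ x : ℝ, 0 < x → L.hockeyStick x ≤ L'.hockeyStick x := by
  constructor
  · rintro ⟨E, E', rfl, rfl, h⟩ x hx
    rw [← E.hockeyStick_eq_pld hx, ← E'.hockeyStick_eq_pld hx]
    exact h.hockeyStick_le hx
  · intro h
    -- The order asks only for some pair of representatives, so the canonical ones suffice.
    obtain ⟨μ, hμ, rfl⟩ := L.exists_isDichotomyLaw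
    obtain ⟨ν, hν, rfl⟩ := L'.exists_isDichotomyLaw
    refine ⟨_, _, rfl, rfl, hμ.blackwellLE hν fun t ht => ?_⟩
    rw [hμ.potential_eq ht, hν.potential_eq ht]
    exact mul_le_mul_of_nonneg_left (h _ (sub_pos.2 (one_lt_one_div ht.1 ht.2))) ht.1.le

theorem eq_of_hockeyStick_eq {L L' : PLD}
    (h : ∀ x : ℝ, 0 < x → L.hockeyStick x = L'.hockeyStick x) : L = L' := by
  obtain ⟨μ, hμ, rfl⟩ := L.exists_isDichotomyLaw
  obtain ⟨ν, hν, rfl⟩ := L'.exists_isDichotomyLaw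
  have : μ = ν := hμ.eq_of_potential_eq hν fun t ht => by
    rw [hμ.potential_eq ht, hν.potential_eq ht, h _ (sub_pos.2 (one_lt_one_div ht.1 ht.2))]
  subst this
  rfl

theorem le_antisymm {L L' : PLD} (h : L ≤ L') (h' : L' ≤ L) : L = L' :=
  eq_of_hockeyStick_eq fun x hx =>
    _root_.le_antisymm (le_iff_hockeyStick_le.1 h x hx) (le_iff_hockeyStick_le.1 h' x hx)

end PLD

/-! ### Which functions are potentials, and suprema of PLDs -/

theorem convexOn_potential (μ : Measure I) [IsFiniteMeasure μ] :
    ConvexOn ℝ univ (potential μ) := by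
  refine ⟨convex_univ, fun a _ b _ s t hs ht hst => ?_⟩
  simp only [potential, smul_eq_mul]
  rw [← integral_const_mul, ← integral_const_mul, ← integral_add
    (by fun_prop : Continuous _).integrable_unitInterval
    (by fun_prop : Continuous _).integrable_unitInterval]
  refine integral_mono (by fun_prop : Continuous _).integrable_unitInterval
    (by fun_prop : Continuous _).integrable_unitInterval fun y => max_le ?_ (by positivity)
  calc s * a + t * b - y = s * (a - y) + t * (b - y) + (s + t - 1) * y := by ring
    _ = s * (a - y) + t * (b - y) := by rw [hst]; ring
    _ ≤ _ := add_le_add (mul_le_mul_of_nonneg_left (le_max_left _ _) hs)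
      (mul_le_mul_of_nonneg_left (le_max_left _ _) ht)

theorem potential_of_nonpos (μ : Measure I) {t : ℝ} (ht : t ≤ 0) : potential μ t = 0 := by
  have : ∀ y : I, max (t - y) 0 = 0 := fun y => max_eq_right (by linarith [y.2.1])
  simp [potential, this]

theorem potential_of_one_le {μ : Measure I} [IsFiniteMeasure μ] {t : ℝ} (ht : 1 ≤ t) :
    potential μ t = t * μ.real univ - ∫ y : I, (y : ℝ) ∂μ := by
  have : ∀ y : I, max (t - y) 0 = t - y := fun y => max_eq_left (by linarith [y.2.2])
  simp_rw [potential, this]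
  rw [integral_sub (by fun_prop : Continuous _).integrable_unitInterval
    (by fun_prop : Continuous _).integrable_unitInterval]
  simp [mul_comm]

theorem potential_le {μ : Measure I} [IsFiniteMeasure μ] (t : ℝ) :
    potential μ t ≤ |t| * μ.real univ := by
  have : ∀ y : I, max (t - y) 0 ≤ |t| := fun y =>
    max_le (by linarith [y.2.1, le_abs_self t]) (abs_nonneg t)
  calc potential μ t ≤ ∫ _ : I, |t| ∂μ := integral_mono
        (by fun_prop : Continuous _).integrable_unitInterval (integrable_const _) this
    _ = _ := by simp [mul_comm]

theorem convexOn_ciSup {ι : Type*} [Nonempty ι] {f : ι → ℝ → ℝ} (hf : ∀ i, ConvexOn ℝ univ (f i))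
    (hbdd : ∀ y, BddAbove (range fun i => f i y)) : ConvexOn ℝ univ fun y => ⨆ i, f i y := by
  refine ⟨convex_univ, fun x _ y _ s t hs ht hst => ciSup_le fun i => ?_⟩
  exact ((hf i).2 (mem_univ x) (mem_univ y) hs ht hst).trans <| add_le_add
    (mul_le_mul_of_nonneg_left (le_ciSup (hbdd x) i) hs)
    (mul_le_mul_of_nonneg_left (le_ciSup (hbdd y) i) ht)

/-- A convex function with the right boundary behaviour is the potential of a dichotomy law. -/
theorem exists_isDichotomyLaw_of_convexOn {W : ℝ → ℝ} (hW : ConvexOn ℝ univ W)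
    (h0 : ∀ t ≤ 0, W t = 0) (h1 : ∀ t, 1 ≤ t → W t = 2 * t - 1) :
    ∃ μ : Measure I, IsDichotomyLaw μ ∧ ∀ t ∈ Ioo (0 : ℝ) 1, potential μ t = W t := by
  obtain ⟨F, hF⟩ := hW.exists_stieltjesFunction
  -- `F t` lies between the difference quotients of `W` on either side of `t`.
  have hF0 : ∀ t < 0, F t = 0 := by
    intro t ht
    have e1 := F.mul_sub_le_integral ht.le
    have e2 := F.integral_le_mul_sub (sub_le_self t zero_le_one)
    rw [← hF _ _ ht.le, h0 _ le_rfl, h0 _ ht.le] at e1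
    rw [← hF _ _ (by linarith), h0 _ ht.le, h0 _ (by linarith)] at e2
    nlinarith
  have hFlt : ∀ t, 1 < t → F t = 2 := by
    intro t ht
    have e1 := F.mul_sub_le_integral (le_add_of_nonneg_right zero_le_one : t ≤ t + 1)
    have e2 := F.integral_le_mul_sub ht.le
    rw [← hF _ _ (by linarith), h1 _ ht.le, h1 _ (by linarith)] at e1
    rw [← hF _ _ ht.le, h1 _ ht.le, h1 _ le_rfl] at e2
    nlinarith
  have hF1 : F 1 = 2 := by
    have e := (F.right_continuous 1).tendsto.mono_left (nhdsWithin_mono _ Ioi_subset_Ici_self)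
    refine tendsto_nhds_unique e (tendsto_const_nhds.congr' ?_)
    filter_upwards [self_mem_nhdsWithin] with t ht
    exact (hFlt t ht).symm
  have hleft : Function.leftLim F 0 = 0 := by
    refine leftLim_eq_of_tendsto (tendsto_const_nhds.congr' ?_)
    filter_upwards [self_mem_nhdsWithin] with t ht
    exact (hF0 t ht).symm
  have hIcc : F.measure (Icc 0 1) = 2 := by rw [F.measure_Icc, hF1, hleft]; simp
  have hfin : IsFiniteMeasure (F.measure.restrict (Icc 0 1)) :=
    ⟨by rw [Measure.restrict_apply_univ, hIcc]; exact ENNReal.ofNat_lt_top⟩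
  have hIoo : F.measure (Ioo (-1) 0) = 0 := by
    rw [F.measure_Ioo, hleft, hF0 (-1) (by norm_num)]; simp
  set μ : Measure I := F.measure.comap Subtype.val with hμ
  have hmass : μ univ = 2 := by
    rw [hμ, comap_subtype_coe_apply measurableSet_Icc, image_univ, Subtype.range_coe]
    exact hIcc
  have hμfin : IsFiniteMeasure μ := ⟨by rw [hmass]; exact ENNReal.ofNat_lt_top⟩
  have hpot : ∀ t ∈ Icc (0 : ℝ) 1, potential μ t = W t := by
    intro t ht
    -- Expanding from `-1` rather than `0` keeps a possible atom at `0`, which `Ioc 0 1` would lose.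
    have e1 := hF (-1) t (by linarith [ht.1])
    rw [F.integral_eq_add_integral_max (by linarith [ht.1]) ht.2, h0 (-1) (by norm_num),
      hF0 (-1) (by norm_num), ← Ioo_union_Icc_eq_Ioc (b := (0 : ℝ)) (by norm_num) (by norm_num),
      setIntegral_union (Set.disjoint_left.2 fun x hx hx' => absurd hx'.1 (not_le.2 hx.2))
        measurableSet_Icc (by rw [IntegrableOn, Measure.restrict_eq_zero.2 hIoo]; simp) ?_,
      setIntegral_measure_zero _ hIoo] at e1
    · have e2 : potential μ t = ∫ x in Icc (0 : ℝ) 1, max (t - x) 0 ∂F.measure :=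
        integral_subtype_comap measurableSet_Icc fun x : ℝ => max (t - x) 0
      linarith
    · refine Integrable.of_bound (C := 1) (by fun_prop : Continuous _).aestronglyMeasurable ?_
      filter_upwards [ae_restrict_mem measurableSet_Icc] with x hx
      rw [Real.norm_of_nonneg (le_max_right _ _)]
      exact max_le (by linarith [ht.2, hx.1]) zero_le_one
  have hreal : μ.real univ = 2 := by simp [Measure.real, hmass]
  refine ⟨μ, .of_real hreal ?_, fun t ht => hpot t ⟨ht.1.le, ht.2.le⟩⟩
  -- The potential at `1` is 2 minus the barycentre, and `W 1 = 1`.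
  have e := hpot 1 ⟨zero_le_one, le_rfl⟩
  rw [potential_of_one_le le_rfl, h1 1 le_rfl, hreal] at e
  linarith

namespace PLD

/-- Every nonempty family of privacy loss distributions has one whose hockey-stick curve is the
supremum of the hockey-stick curves of the family. -/
theorem exists_isLUB_hockeyStick {𝓛 : Set PLD} (hne : 𝓛.Nonempty) :
    ∃ S : PLD, ∀ x : ℝ, 0 < x → IsLUB {y | ∃ L ∈ 𝓛, L.hockeyStick x = y} (S.hockeyStick x) := by
  have : Nonempty 𝓛 := hne.to_subtype
  choose law hlaw hpld using exists_isDichotomyLaw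
  have hfin : ∀ L, IsFiniteMeasure (law L) := fun L => (hlaw L).isFiniteMeasure
  have hbdd : ∀ t, BddAbove (range fun L : 𝓛 => potential (law L) t) := by
    rintro t
    refine ⟨|t| * 2, ?_⟩
    rintro _ ⟨L, rfl⟩
    exact (potential_le t).trans_eq (by rw [(hlaw L).real_univ])
  -- The values outside `(0, 1)` are common to all dichotomy laws, so the supremum keeps them.
  obtain ⟨μ, hμ, hpot⟩ := exists_isDichotomyLaw_of_convexOn
    (convexOn_ciSup (fun L : 𝓛 => convexOn_potential (law L)) hbdd)
    (fun t ht => by simp [potential_of_nonpos _ ht])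
    (fun t ht => by
      have : ∀ L : 𝓛, potential (law L) t = 2 * t - 1 := fun L => by
        rw [potential_of_one_le ht, (hlaw L).real_univ, (hlaw L).integral_eq, mul_comm]
      simp [this])
  refine ⟨hμ.testingPair.pld, fun x hx => ?_⟩
  have hx1 : 0 < 1 + x := by linarith
  have heq : ∀ L, L.hockeyStick x = (1 + x) * potential (law L) (1 / (1 + x)) := fun L => by
    rw [← (hlaw L).pld_hockeyStick hx, hpld]
  rw [hμ.pld_hockeyStick hx, hpot _ ⟨by positivity, by rw [div_lt_one hx1]; linarith⟩]
  constructor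
  · rintro _ ⟨L, hL, rfl⟩
    rw [heq]
    exact mul_le_mul_of_nonneg_left (le_ciSup (hbdd _) ⟨L, hL⟩) hx1.le
  · intro b hb
    rw [← le_div_iff₀' hx1]
    refine ciSup_le fun L => ?_
    rw [le_div_iff₀' hx1, ← heq]
    exact hb ⟨L, L.2, rfl⟩

theorem isLUB_of_isLUB_hockeyStick {𝓛 : Set PLD} {S : PLD}
    (h : ∀ x : ℝ, 0 < x → IsLUB {y | ∃ L ∈ 𝓛, L.hockeyStick x = y} (S.hockeyStick x)) :
    IsLUB 𝓛 S := by
  refine ⟨fun L hL => le_iff_hockeyStick_le.2 fun x hx => (h x hx).1 ⟨L, hL, rfl⟩, fun U hU => ?_⟩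
  refine le_iff_hockeyStick_le.2 fun x hx => (h x hx).2 ?_
  rintro _ ⟨L, hL, rfl⟩
  exact le_iff_hockeyStick_le.1 (hU hL) x hx

end PLD

/-! ### Duality between tradeoff and hockey-stick curves -/

theorem ConvexOn.exists_supporting_line {f : ℝ → ℝ} (hf : ConvexOn ℝ (Icc 0 1) f) {a : ℝ}
    (ha : a ∈ Ioo (0 : ℝ) 1) : ∃ s, ∀ b ∈ Icc (0 : ℝ) 1, f a + s * (b - a) ≤ f b := by
  have hint : a ∈ interior (Icc (0 : ℝ) 1) := by rwa [interior_Icc]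
  refine ⟨derivWithin f (Ioi a) a, fun b hb => ?_⟩
  rcases lt_trichotomy a b with hab | rfl | hab
  · have h := hf.rightDeriv_le_slope_of_mem_interior hint hb hab
    rw [slope_def_field, le_div_iff₀ (sub_pos.2 hab)] at h
    linarith
  · simp
  · have h := (hf.slope_le_leftDeriv_of_mem_interior hb hint hab).trans
      (hf.leftDeriv_le_rightDeriv_of_mem_interior hint)
    rw [slope_def_field, div_le_iff₀ (sub_pos.2 hab)] at h
    linarith

namespace TestingPair

variable (E : TestingPair)

theorem integrable_of_test {φ : E.Ω → ℝ} (hφ : Measurable φ) (h01 : ∀ ω, φ ω ∈ Icc (0 : ℝ) 1)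
    (R : Measure E.Ω) [IsFiniteMeasure R] : Integrable φ R :=
  Integrable.of_bound hφ.aestronglyMeasurable 1 (.of_forall fun ω => by
    rw [Real.norm_of_nonneg (h01 ω).1]; exact (h01 ω).2)

theorem tradeoff_le {α : ℝ} {φ : E.Ω → ℝ} (hφ : Measurable φ) (h01 : ∀ ω, φ ω ∈ Icc (0 : ℝ) 1)
    (hα : ∫ ω, φ ω ∂E.P ≤ α) : E.tradeoff α ≤ ∫ ω, (1 - φ ω) ∂E.Q := by
  refine csInf_le ⟨0, ?_⟩ ⟨φ, hφ, h01, hα, rfl⟩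
  rintro _ ⟨ψ, -, hψ, -, rfl⟩
  exact integral_nonneg fun ω => sub_nonneg.2 (hψ ω).2

theorem le_tradeoff {α c : ℝ} (hα : 0 ≤ α)
    (h : ∀ φ : E.Ω → ℝ, Measurable φ → (∀ ω, φ ω ∈ Icc (0 : ℝ) 1) → ∫ ω, φ ω ∂E.P ≤ α →
      c ≤ ∫ ω, (1 - φ ω) ∂E.Q) : c ≤ E.tradeoff α := by
  refine le_csInf ⟨_, fun _ => 0, measurable_const, by simp, by simpa, rfl⟩ ?_
  rintro _ ⟨φ, hφ, h01, hle, rfl⟩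
  exact h φ hφ h01 hle

theorem tradeoff_nonneg {α : ℝ} (hα : 0 ≤ α) : 0 ≤ E.tradeoff α :=
  E.le_tradeoff hα fun _ _ h01 _ => integral_nonneg fun ω => sub_nonneg.2 (h01 ω).2

theorem tradeoff_anti {α β : ℝ} (hα : 0 ≤ α) (h : α ≤ β) : E.tradeoff β ≤ E.tradeoff α :=
  E.le_tradeoff hα fun _ hφ h01 hle => E.tradeoff_le hφ h01 (hle.trans h)

theorem tradeoff_one : E.tradeoff 1 = 0 := by
  refine le_antisymm ?_ (E.tradeoff_nonneg zero_le_one)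
  simpa using E.tradeoff_le (α := 1) (φ := fun _ => 1) measurable_const (by simp) (by simp)

/-- Mixing two tests mixes both of their errors. -/
theorem convexOn_tradeoff : ConvexOn ℝ (Icc 0 1) E.tradeoff := by
  refine ⟨convex_Icc _ _, fun a ha b hb s t hs ht hst => ?_⟩
  have hkey : ∀ φ : E.Ω → ℝ, Measurable φ → (∀ ω, φ ω ∈ Icc (0 : ℝ) 1) → ∫ ω, φ ω ∂E.P ≤ a →
      ∀ ψ : E.Ω → ℝ, Measurable ψ → (∀ ω, ψ ω ∈ Icc (0 : ℝ) 1) → ∫ ω, ψ ω ∂E.P ≤ b →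
      E.tradeoff (s * a + t * b) ≤ s * ∫ ω, (1 - φ ω) ∂E.Q + t * ∫ ω, (1 - ψ ω) ∂E.Q := by
    intro φ hφ hφ1 hφa ψ hψ hψ1 hψb
    have h := E.tradeoff_le (α := s * a + t * b) (φ := fun ω => s * φ ω + t * ψ ω) (by fun_prop)
      (fun ω => (convex_Icc (0 : ℝ) 1) (hφ1 ω) (hψ1 ω) hs ht hst) (by
        rw [integral_add ((E.integrable_of_test hφ hφ1 _).const_mul s)
          ((E.integrable_of_test hψ hψ1 _).const_mul t), integral_const_mul, integral_const_mul]
        exact add_le_add (mul_le_mul_of_nonneg_left hφa hs) (mul_le_mul_of_nonneg_left hψb ht))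
    refine h.trans_eq ?_
    rw [← integral_const_mul, ← integral_const_mul, ← integral_add]
    rotate_left
    · exact ((integrable_const _).sub (E.integrable_of_test hφ hφ1 _)).const_mul s
    · exact ((integrable_const _).sub (E.integrable_of_test hψ hψ1 _)).const_mul t
    congr 1
    ext ω
    linear_combination -hst
  simp only [smul_eq_mul]
  -- The two infima are taken one at a time after dividing by the weights, which must be positive.
  rcases hs.eq_or_lt with rfl | hs'
  · obtain rfl : t = 1 := by linarith
    simp
  rcases ht.eq_or_lt with rfl | ht'
  · obtain rfl : s = 1 := by linarith
    simp
  have h1 : (E.tradeoff (s * a + t * b) - t * E.tradeoff b) / s ≤ E.tradeoff a := by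
    refine E.le_tradeoff ha.1 fun φ hφ hφ1 hφa => ?_
    have h2 : (E.tradeoff (s * a + t * b) - s * ∫ ω, (1 - φ ω) ∂E.Q) / t ≤ E.tradeoff b := by
      refine E.le_tradeoff hb.1 fun ψ hψ hψ1 hψb => ?_
      rw [div_le_iff₀ ht']
      linarith [hkey φ hφ hφ1 hφa ψ hψ hψ1 hψb]
    rw [div_le_iff₀ ht'] at h2
    rw [div_le_iff₀ hs']
    linarith
  rw [div_le_iff₀ hs'] at h1
  linarith

/-- Weak duality between the tradeoff curve and the hockey-stick curve. -/
theorem sub_hockeyStick_div_le_tradeoff {α x : ℝ} (hα : 0 ≤ α) (hx : 0 < x) :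
    (1 - α - E.hockeyStick x) / x ≤ E.tradeoff α := by
  refine E.le_tradeoff hα fun φ hφ h01 hle => ?_
  -- Applied to `1 - φ`, whose `P`-integral is at least `1 - α` and whose `Q`-integral is the type
  -- II error.
  have h := E.integral_sub_le_hockeyStick (φ := fun ω => 1 - φ ω) (by fun_prop)
    (fun ω => ⟨sub_nonneg.2 (h01 ω).2, sub_le_self _ (h01 ω).1⟩) hx
  rw [integral_sub (integrable_const _) (E.integrable_of_test hφ h01 _)] at h
  simp only [integral_const, probReal_univ, smul_eq_mul, mul_one] at h
  rw [div_le_iff₀ hx]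
  linarith

/-- A convex minorant of the tradeoff curves is either nonpositive at a given point, or it is
bounded there in terms of the hockey-stick curves. -/
theorem _root_.ConvexOn.exists_hockeyStick_le {f : ℝ → ℝ} (hf : ConvexOn ℝ (Icc 0 1) f)
    (hf1 : f 1 ≤ 0) {α : ℝ} (hα : α ∈ Ioo (0 : ℝ) 1) :
    f α ≤ 0 ∨ ∃ x : ℝ, 0 < x ∧ ∀ E : TestingPair, (∀ β ∈ Icc (0 : ℝ) 1, f β ≤ E.tradeoff β) →
      E.hockeyStick x ≤ 1 - α - x * f α := by
  obtain ⟨s, hs⟩ := hf.exists_supporting_line hα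
  rcases le_or_gt 0 s with h0 | h0
  · left
    have := hs 1 ⟨zero_le_one, le_rfl⟩
    have := mul_nonneg h0 (sub_nonneg.2 hα.2.le)
    linarith
  -- A line of slope `s` has the form `(1 - β - H)/x` with `x = -1/s`; this `x` depends on `f`
  -- alone, not on `E`.
  refine .inr ⟨-s⁻¹, neg_pos.2 (inv_lt_zero.2 h0), fun E hE => ?_⟩
  refine csSup_le ⟨_, ∅, .empty, rfl⟩ ?_
  rintro _ ⟨A, hA, rfl⟩
  -- The test deciding for `Q` off `A` has errors `1 - P(A)` and `Q(A)`.
  have hP : ∫ ω, Aᶜ.indicator (1 : E.Ω → ℝ) ω ∂E.P = 1 - E.P.real A := by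
    rw [integral_indicator_one hA.compl, probReal_compl_eq_one_sub hA]
  have hQ : ∫ ω, (1 - Aᶜ.indicator (1 : E.Ω → ℝ) ω) ∂E.Q = E.Q.real A := by
    rw [← integral_indicator_one hA]
    congr 1
    ext ω
    by_cases hω : ω ∈ A <;> simp [hω]
  have h1 := E.tradeoff_le (measurable_one.indicator hA.compl) (fun ω => by
    by_cases hω : ω ∈ A <;> simp [hω]) hP.le
  rw [hQ] at h1
  have hb : 1 - E.P.real A ∈ Icc (0 : ℝ) 1 :=
    ⟨sub_nonneg.2 measureReal_le_one, sub_le_self _ measureReal_nonneg⟩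
  have h2 := (hs _ hb).trans ((hE _ hb).trans h1)
  have h3 : -s⁻¹ * (f α + s * (1 - E.P.real A - α)) ≤ -s⁻¹ * E.Q.real A :=
    mul_le_mul_of_nonneg_left h2 (neg_pos.2 (inv_lt_zero.2 h0)).le
  have h4 : -s⁻¹ * (f α + s * (1 - E.P.real A - α)) = -s⁻¹ * f α - (1 - E.P.real A - α) := by
    have := inv_mul_cancel₀ h0.ne
    linear_combination -(1 - E.P.real A - α) * this
  linarith

/-- The test deciding for `Q` on `{y = 1}` has type I error 0 and type II error `Q(y < 1)`. The
optimal sets for `x = 1/(n+1)` increase to `{y < 1}`, and each has `Q`-mass at most `(1 - H_x)/x`,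
because `P ≤ 1`. -/
theorem tradeoff_zero_le {c : ℝ} (hc : ∀ x : ℝ, 0 < x → (1 - E.hockeyStick x) / x ≤ c) :
    E.tradeoff 0 ≤ c := by
  obtain ⟨y, h⟩ := E.exists_hasDensity
  have hm := h.measurable_coe
  set A : ℕ → Set E.Ω := fun n => {ω | (1 + 1 / (n + 1 : ℝ)) * (y ω : ℝ) ≤ 1} with hA
  have hAm : ∀ n, MeasurableSet (A n) := fun n => measurableSet_le (by fun_prop) measurable_const
  obtain ⟨B, hB⟩ : ∃ B : Set E.Ω, ∀ ω, ω ∈ B ↔ (y ω : ℝ) = 1 := ⟨{ω | (y ω : ℝ) = 1}, fun _ => Iff.rfl⟩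
  have hUm : MeasurableSet B := by
    rw [show B = {ω | (y ω : ℝ) = 1} from Set.ext hB]
    exact measurableSet_eq_fun hm measurable_const
  have hmono : Monotone A := by
    intro m n hmn ω hω
    have hω' : (1 + 1 / (m + 1 : ℝ)) * (y ω : ℝ) ≤ 1 := hω
    have : (1 : ℝ) / (n + 1) ≤ 1 / (m + 1) := Nat.one_div_le_one_div hmn
    exact (mul_le_mul_of_nonneg_right (by linarith) (y ω).2.1).trans hω'
  have hU : ⋃ n, A n = Bᶜ := by
    ext ω
    simp only [mem_iUnion, mem_compl_iff, hB]
    constructor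
    · rintro ⟨n, hn⟩ h1
      have hn' : (1 + 1 / (n + 1 : ℝ)) * (y ω : ℝ) ≤ 1 := hn
      have h1' : (y ω : ℝ) = 1 := h1
      have : (0 : ℝ) < 1 / (n + 1) := by positivity
      rw [h1'] at hn'
      linarith
    · intro h1
      have hlt : (y ω : ℝ) < 1 := lt_of_le_of_ne (y ω).2.2 h1
      have ht : Filter.Tendsto (fun n : ℕ => (1 + 1 / (n + 1 : ℝ)) * (y ω : ℝ)) Filter.atTop
          (nhds ((1 + 0) * (y ω : ℝ))) :=
        (tendsto_one_div_add_atTop_nhds_zero_nat.const_add 1).mul_const _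
      obtain ⟨n, hn⟩ := (ht.eventually_lt_const (by rwa [add_zero, one_mul])).exists
      exact ⟨n, hn.le⟩
  have hP0 : ∫ ω, B.indicator (1 : E.Ω → ℝ) ω ∂E.P ≤ 0 := by
    rw [h.integral_P]
    refine (integral_eq_zero_of_ae (.of_forall fun ω => ?_)).le
    by_cases hω : ω ∈ B
    · have : (y ω : ℝ) = 1 := (hB ω).1 hω
      simp [this]
    · simp [indicator_of_notMem hω]
  have h1 := E.tradeoff_le (measurable_one.indicator hUm) (fun ω => by
    by_cases hω : ω ∈ B
    · simp [hω]
    · simp [hω]) hP0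
  have h2 : ∫ ω, (1 - B.indicator (1 : E.Ω → ℝ) ω) ∂E.Q =
      E.Q.real (⋃ n, A n) := by
    rw [hU, ← integral_indicator_one hUm.compl]
    congr 1
    ext ω
    by_cases hω : ω ∈ B
    · simp [hω]
    · simp [hω]
  rw [h2] at h1
  have ht : Filter.Tendsto (fun n => E.Q.real (A n)) Filter.atTop (nhds (E.Q.real (⋃ n, A n))) :=
    (ENNReal.tendsto_toReal (measure_ne_top _ _)).comp (tendsto_measure_iUnion_atTop hmono)
  refine h1.trans (le_of_tendsto' ht fun n => le_trans ?_ (hc (1 / (n + 1)) (by positivity)))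
  have hx : (0 : ℝ) < 1 / (n + 1) := by positivity
  rw [le_div_iff₀ hx, h.hockeyStick_eq hx, ← h.real_sub_eq hx]
  have : E.P.real (A n) ≤ 1 := measureReal_le_one
  simp only [hA] at this ⊢
  linarith

end TestingPair

namespace PLD

theorem isLUB_hockeyStick {𝓛 : Set PLD} (hne : 𝓛.Nonempty) {S : PLD} (hS : IsLUB 𝓛 S) {x : ℝ}
    (hx : 0 < x) : IsLUB {y | ∃ L ∈ 𝓛, L.hockeyStick x = y} (S.hockeyStick x) := by
  obtain ⟨S', hS'⟩ := exists_isLUB_hockeyStick hne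
  have h' := isLUB_of_isLUB_hockeyStick hS'
  rw [le_antisymm (hS.2 h'.1) (h'.2 hS.1)]
  exact hS' x hx

theorem isLUB_testingPair_hockeyStick {𝓛 : Set PLD} (hne : 𝓛.Nonempty) {E : TestingPair}
    (hE : IsLUB 𝓛 E.pld) {x : ℝ} (hx : 0 < x) :
    IsLUB {y | ∃ E' : TestingPair, E'.pld ∈ 𝓛 ∧ E'.hockeyStick x = y} (E.hockeyStick x) := by
  have heq : {y | ∃ E' : TestingPair, E'.pld ∈ 𝓛 ∧ E'.hockeyStick x = y} =
      {y | ∃ L ∈ 𝓛, L.hockeyStick x = y} := by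
    ext y
    constructor
    · rintro ⟨E', h, rfl⟩
      exact ⟨_, h, (E'.hockeyStick_eq_pld hx).symm⟩
    · rintro ⟨⟨_, E', rfl⟩, h, rfl⟩
      exact ⟨E', h, E'.hockeyStick_eq_pld hx⟩
  rw [heq, E.hockeyStick_eq_pld hx]
  exact isLUB_hockeyStick hne hE hx

end PLD

/-! ### The tradeoff curve of the supremum as an envelope -/

section Envelope

variable {𝓛 : Set PLD} {E : TestingPair} {f : ℝ → ℝ} {α : ℝ}

theorem apply_one_nonpos_of_mem_convexMinorants (hne : 𝓛.Nonempty)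
    (hf : f ∈ convexMinorants (tradeoffCurves 𝓛)) : f 1 ≤ 0 := by
  obtain ⟨⟨_, E', rfl⟩, hL⟩ := hne
  exact (hf.2 _ ⟨E', hL, rfl⟩ 1 ⟨zero_le_one, le_rfl⟩).trans_eq E'.tradeoff_one

/-- The bound from the supporting line holds for the whole family with one `x`, hence for its
supremum; weak duality turns it back into a bound on the tradeoff curve. -/
theorem le_tradeoff_of_mem_convexMinorants (hne : 𝓛.Nonempty) (hE : IsLUB 𝓛 E.pld)
    (hf : f ∈ convexMinorants (tradeoffCurves 𝓛)) (hα : α ∈ Ioc (0 : ℝ) 1) :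
    f α ≤ E.tradeoff α := by
  have hf1 := apply_one_nonpos_of_mem_convexMinorants hne hf
  rcases hα.2.lt_or_eq with h1 | rfl
  · rcases hf.1.exists_hockeyStick_le hf1 ⟨hα.1, h1⟩ with h | ⟨x, hx, h⟩
    · exact h.trans (E.tradeoff_nonneg hα.1.le)
    · refine le_trans ?_ (E.sub_hockeyStick_div_le_tradeoff hα.1.le hx)
      rw [le_div_iff₀ hx]
      have : E.hockeyStick x ≤ 1 - α - x * f α := by
        refine (PLD.isLUB_testingPair_hockeyStick hne hE hx).2 ?_
        rintro _ ⟨E', hE', rfl⟩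
        exact h E' fun β hβ => hf.2 _ ⟨E', hE', rfl⟩ β hβ
      linarith
  · exact hf1.trans (E.tradeoff_nonneg zero_le_one)

/-- At `0`, `f 0` is the limit of values `f β ≤ T β ≤ T 0` as `β` decreases to `0`. -/
theorem le_tradeoff_of_continuousOn (hne : 𝓛.Nonempty) (hE : IsLUB 𝓛 E.pld)
    (hf : f ∈ convexMinorants (tradeoffCurves 𝓛)) (hfc : ContinuousOn f (Icc 0 1))
    (hα : α ∈ Icc (0 : ℝ) 1) : f α ≤ E.tradeoff α := by
  rcases hα.1.eq_or_lt with rfl | h0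
  · have h1 : Filter.Tendsto f (nhdsWithin 0 (Ioo 0 1)) (nhds (f 0)) :=
      (hfc 0 hα).tendsto.mono_left (nhdsWithin_mono _ Ioo_subset_Icc_self)
    have : (nhdsWithin (0 : ℝ) (Ioo 0 1)).NeBot := left_nhdsWithin_Ioo_neBot zero_lt_one
    refine le_of_tendsto h1 ?_
    filter_upwards [self_mem_nhdsWithin] with β hβ
    exact (le_tradeoff_of_mem_convexMinorants hne hE hf ⟨hβ.1, hβ.2.le⟩).trans
      (E.tradeoff_anti le_rfl hβ.1.le)
  · exact le_tradeoff_of_mem_convexMinorants hne hE hf ⟨h0, hα.2⟩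

theorem zero_mem_convexMinorants : (fun _ => 0) ∈ convexMinorants (tradeoffCurves 𝓛) := by
  refine ⟨convexOn_const 0 (convex_Icc 0 1), ?_⟩
  rintro _ ⟨E', -, rfl⟩ β hβ
  exact E'.tradeoff_nonneg hβ.1

theorem affine_mem_convexMinorants (hne : 𝓛.Nonempty) (hE : IsLUB 𝓛 E.pld) {x : ℝ} (hx : 0 < x) :
    (fun β => (1 - β - E.hockeyStick x) / x) ∈ convexMinorants (tradeoffCurves 𝓛) := by
  constructor
  · refine ⟨convex_Icc 0 1, fun a _ b _ s t _ _ hst => le_of_eq ?_⟩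
    simp only [smul_eq_mul]
    field_simp
    linear_combination (E.hockeyStick x - 1) * hst
  · rintro _ ⟨E', hE', rfl⟩ β hβ
    refine le_trans ?_ (E'.sub_hockeyStick_div_le_tradeoff hβ.1 hx)
    have := (PLD.isLUB_testingPair_hockeyStick hne hE hx).1 ⟨E', hE', rfl⟩
    exact div_le_div_of_nonneg_right (by linarith) hx.le

theorem tradeoff_le_of_continuous_minorants (hne : 𝓛.Nonempty) (hE : IsLUB 𝓛 E.pld)
    (hα : α ∈ Icc (0 : ℝ) 1) {c : ℝ} (hc : ∀ f ∈ convexMinorants (tradeoffCurves 𝓛),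
      ContinuousOn f (Icc 0 1) → f α ≤ c) : E.tradeoff α ≤ c := by
  have hzero : 0 ≤ c := hc _ zero_mem_convexMinorants continuousOn_const
  have haff : ∀ x, 0 < x → (1 - α - E.hockeyStick x) / x ≤ c := fun x hx =>
    hc _ (affine_mem_convexMinorants hne hE hx) (by fun_prop)
  rcases hα.1.eq_or_lt with rfl | h0
  · exact E.tradeoff_zero_le fun x hx => by simpa using haff x hx
  rcases hα.2.lt_or_eq with h1 | rfl
  · rcases E.convexOn_tradeoff.exists_hockeyStick_le E.tradeoff_one.le ⟨h0, h1⟩ with h | ⟨x, hx, h⟩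
    · exact h.trans hzero
    · refine le_trans ?_ (haff x hx)
      rw [le_div_iff₀ hx]
      linarith [h E fun _ _ => le_rfl]
  · exact E.tradeoff_one.trans_le hzero

theorem tradeoff_eq_closedLowerConvexEnvelope (hne : 𝓛.Nonempty) (hE : IsLUB 𝓛 E.pld)
    (hα : α ∈ Icc (0 : ℝ) 1) :
    E.tradeoff α = closedLowerConvexEnvelope (tradeoffCurves 𝓛) α := by
  refine Eq.symm (IsLUB.csSup_eq ⟨?_, fun c hc => ?_⟩
    ⟨0, _, zero_mem_convexMinorants, continuousOn_const, rfl⟩)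
  · rintro _ ⟨f, hf, hfc, rfl⟩
    exact le_tradeoff_of_continuousOn hne hE hf hfc hα
  · exact tradeoff_le_of_continuous_minorants hne hE hα fun f hf hfc => hc ⟨f, hf, hfc, rfl⟩

theorem tradeoff_eq_lowerConvexEnvelope (hne : 𝓛.Nonempty) (hE : IsLUB 𝓛 E.pld)
    (hα : α ∈ Ioc (0 : ℝ) 1) :
    E.tradeoff α = lowerConvexEnvelope (tradeoffCurves 𝓛) α := by
  refine Eq.symm (IsLUB.csSup_eq ⟨?_, fun c hc => ?_⟩ ⟨0, _, zero_mem_convexMinorants, rfl⟩)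
  · rintro _ ⟨f, hf, rfl⟩
    exact le_tradeoff_of_mem_convexMinorants hne hE hf hα
  · exact tradeoff_le_of_continuous_minorants hne hE ⟨hα.1.le, hα.2⟩
      fun f hf _ => hc ⟨f, hf, rfl⟩

end Envelope

theorem mainTheorem6 (𝓛 : Set PLD) (hne : 𝓛.Nonempty) (hbdd : BddAbove 𝓛) :
    (∃! S : PLD, IsLUB 𝓛 S) ∧
    ∀ S : PLD, IsLUB 𝓛 S →
      -- the hockey-stick curve, through its formula in terms of the PLD
      (∀ x : ℝ, 0 < x → IsLUB {y | ∃ L ∈ 𝓛, L.hockeyStick x = y} (S.hockeyStick x)) ∧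
      -- the curves of an arbitrary testing problem whose PLD is `S`
      ∀ E : TestingPair, E.pld = S →
        (∀ x : ℝ, 0 < x →
          IsLUB {y | ∃ E' : TestingPair, E'.pld ∈ 𝓛 ∧ E'.hockeyStick x = y} (E.hockeyStick x)) ∧
        (∀ α ∈ Set.Icc (0 : ℝ) 1,
          E.tradeoff α = closedLowerConvexEnvelope (tradeoffCurves 𝓛) α) ∧
        (∀ α ∈ Set.Ioc (0 : ℝ) 1,
          E.tradeoff α = lowerConvexEnvelope (tradeoffCurves 𝓛) α) := by
  obtain ⟨S₀, hS₀⟩ := PLD.exists_isLUB_hockeyStick hne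
  refine ⟨⟨S₀, PLD.isLUB_of_isLUB_hockeyStick hS₀, fun S hS => ?_⟩, fun S hS =>
    ⟨fun x hx => PLD.isLUB_hockeyStick hne hS hx, ?_⟩⟩
  · have h' := PLD.isLUB_of_isLUB_hockeyStick hS₀
    exact PLD.le_antisymm (hS.2 h'.1) (h'.2 hS.1)
  · rintro E rfl
    exact ⟨fun x hx => PLD.isLUB_testingPair_hockeyStick hne hS hx,
      fun α hα => tradeoff_eq_closedLowerConvexEnvelope hne hS hα,
      fun α hα => tradeoff_eq_lowerConvexEnvelope hne hS hα⟩
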